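/- Let $F$ be a finite field, let $n,k$ be non-negative integers with $k<\frac n4$, and let $\rho$ be an irreducible complex (finite-dimensional) representation of $GL_n=GL_n(F)$. **$U$-rank.** A *standard matrix subgroup* $U\cong M_{a,b}(F)$ of $GL_n$ consists of the matrices $I+\widetilde T$, $T\in M_{a,b}(F)$, where $\widetilde T$ is the $n\times n$ matrix with $T$ placed in $a$ consecutive rows and $b$ consecutive columns, all these rows preceding all these columns, and zeros elsewhere. Fix a non-trivial character $\chi_0$ of the additive group of $F$; each character of $U$ has the form $T\mapsto\chi_0(\operatorname{tr}(ST))$ for a unique $S\in M_{b,a}(F)$, and its rank is the rank of $S$. The $U$-rank of $\rho$ is the largest rank of a character appearing in $\rho|_U$, as $U$ varies over all standard matrix subgroups of $GL_n$. **Tensor rank.** Let $GL_n$ act on the space $L^2(F^n)$ of complex functions on $F^n$ by $(g f)(x)=f(g^{-1}x)$. The representation $\rho$ has tensor rank at most $m$ if, for some $\ell\le m$ and some one-dimensional character $\chi$ of $GL_n$, it is a component of $\chi\otimes\sigma_1\otimes\cdots\otimes\sigma_\ell$, where $\sigma_1,\dots,\sigma_\ell$ are irreducible components of $L^2(F^n)$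 (for $\ell=0$ the product is the trivial representation). The tensor rank of $\rho$ is the least such $m$. **Proposition.** If $\rho$ has $U$-rank $k$ (and $k<\frac n4$), then the tensor rank of $\rho$ is equal to $k$. -/

import Mathlib

open scoped TensorProduct

namespace GLRank

/-! ### Standard matrix subgroups of `GL_n` -/

/-- Position of an `a × b` block strictly above the diagonal in `n × n` matrices: the rows
`row, …, row + a - 1` and the columns `col, …, col + b - 1`, all rows preceding all columns.
These are the positions of the off-diagonal blocks `T_{jk}` (`j < k`) of the block upper
triangular parabolic subgroups of `GL_n`. -/
structure StandardBlock (n a b : ℕ) where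
  row : ℕ
  col : ℕ
  row_le : row + a ≤ col
  col_le : col + b ≤ n

namespace StandardBlock

variable {n a b : ℕ} (B : StandardBlock n a b)

/-- The `s`-th row of the block, as a row index of an `n × n` matrix. -/
def rowIdx (s : Fin a) : Fin n :=
  ⟨B.row + s, by have := B.row_le; have := B.col_le; have := s.isLt; omega⟩

/-- The `t`-th column of the block, as a column index of an `n × n` matrix. -/
def colIdx (t : Fin b) : Fin n :=
  ⟨B.col + t, by have := B.col_le; have := t.isLt; omega⟩

theorem colIdx_ne_rowIdx (t : Fin b) (s : Fin a) : B.colIdx t ≠ B.rowIdx s := by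
  intro h
  have h1 := congrArg Fin.val h
  have h2 := B.row_le
  have h3 := s.isLt
  simp only [colIdx, rowIdx] at h1
  omega

variable {F : Type*} [Field F]

/-- The `n × n` matrix with the `a × b` matrix `T` placed in the block, and zeros elsewhere. -/
def place (T : Matrix (Fin a) (Fin b) F) : Matrix (Fin n) (Fin n) F :=
  (1 : Matrix (Fin n) (Fin n) F).submatrix id B.rowIdx * T *
    (1 : Matrix (Fin n) (Fin n) F).submatrix B.colIdx id

theorem place_mul_place (S T : Matrix (Fin a) (Fin b) F) : B.place S * B.place T = 0 := by
  have h : (1 : Matrix (Fin n) (Fin n) F).submatrix B.colIdx id *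
      (1 : Matrix (Fin n) (Fin n) F).submatrix id B.rowIdx = 0 := by
    ext t s
    simp [Matrix.mul_apply, Matrix.one_apply, B.colIdx_ne_rowIdx]
  unfold place
  calc _ = (1 : Matrix (Fin n) (Fin n) F).submatrix id B.rowIdx * S *
        ((1 : Matrix (Fin n) (Fin n) F).submatrix B.colIdx id *
          (1 : Matrix (Fin n) (Fin n) F).submatrix id B.rowIdx) * T *
        (1 : Matrix (Fin n) (Fin n) F).submatrix B.colIdx id := by
          simp only [Matrix.mul_assoc]
    _ = 0 := by rw [h]; simp

theorem place_add (S T : Matrix (Fin a) (Fin b) F) :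
    B.place (S + T) = B.place S + B.place T := by
  simp [place, Matrix.mul_add, Matrix.add_mul]

theorem place_zero : B.place (0 : Matrix (Fin a) (Fin b) F) = 0 := by
  simp [place]

/-- The standard matrix subgroup of `GL_n` at the block, as a homomorphism
`T ↦ I + (T placed in the block)` from the additive group `M_{a,b}(F)` to `GL_n(F)`. -/
def unipotent : Multiplicative (Matrix (Fin a) (Fin b) F) →* GL (Fin n) F where
  toFun T :=
    { val := 1 + B.place T.toAdd
      inv := 1 - B.place T.toAdd
      val_inv := by simp [mul_sub, add_mul, place_mul_place]
      inv_val := by simp [mul_add, sub_mul, place_mul_place] }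
  map_one' := by ext1; simp [place_zero]
  map_mul' S T := by
    ext1
    simp [place_add, mul_add, add_mul, place_mul_place, add_assoc]

end StandardBlock

/-! ### The `U`-rank -/

section URank

variable {F : Type*} [Field F] {n : ℕ} {V : Type*} [AddCommGroup V] [Module ℂ V]

/-- The character `T ↦ χ₀ (tr (S T))` of the additive group `M_{a,b}(F)`, for `S` in `M_{b,a}(F)`.
When `F` is finite and `χ₀` is non-trivial, every character of `M_{a,b}(F)` is of this form for
exactly one `S`, and the rank of the character is by definition the rank of `S`. -/
def matrixChar (χ₀ : AddChar F ℂ) {a b : ℕ} (S : Matrix (Fin b) (Fin a) F) :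
    AddChar (Matrix (Fin a) (Fin b) F) ℂ where
  toFun T := χ₀ (Matrix.trace (S * T))
  map_zero_eq_one' := by simp
  map_add_eq_mul' T T' := by simp [Matrix.mul_add, AddChar.map_add_eq_mul]

/-- The character `ψ` appears in the restriction of `ρ` to the standard matrix subgroup at `B`:
the space of `ρ` contains an eigenvector for that subgroup with eigencharacter `ψ`. -/
def CharAppears (ρ : Representation ℂ (GL (Fin n) F) V) {a b : ℕ} (B : StandardBlock n a b)
    (ψ : AddChar (Matrix (Fin a) (Fin b) F) ℂ) : Prop :=
  ∃ v : V, v ≠ 0 ∧ ∀ T : Matrix (Fin a) (Fin b) F,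
    ρ (B.unipotent (Multiplicative.ofAdd T)) v = ψ T • v

/-- `ρ` has `U`-rank `k`: the largest rank of a character that appears in the restriction of `ρ`
to some standard matrix subgroup of `GL_n` is `k`. -/
def HasURank (χ₀ : AddChar F ℂ) (ρ : Representation ℂ (GL (Fin n) F) V) (k : ℕ) : Prop :=
  IsGreatest {r : ℕ | ∃ (a b : ℕ) (B : StandardBlock n a b) (S : Matrix (Fin b) (Fin a) F),
    CharAppears ρ B (matrixChar χ₀ S) ∧ S.rank = r} k

end URank

/-! ### The tensor rank -/

section TensorRank

/-- The tensor product of a finite family of representations of `G`, with the diagonal action. -/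
noncomputable def tensorFamily {G : Type*} [Monoid G] {ι : Type*} {W : ι → Type*}
    [∀ i, AddCommGroup (W i)] [∀ i, Module ℂ (W i)] (σ : ∀ i, Representation ℂ G (W i)) :
    Representation ℂ G (⨂[ℂ] i, W i) where
  toFun g := PiTensorProduct.map fun i => σ i g
  map_one' := by simp only [map_one, PiTensorProduct.map_one]
  map_mul' g h := by simp only [map_mul, PiTensorProduct.map_mul]

/-- The twist `χ ⊗ σ` of a representation by a one-dimensional character. -/
noncomputable def twist {G : Type*} [Group G] {W : Type*} [AddCommGroup W] [Module ℂ W]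
    (χ : G →* ℂˣ) (σ : Representation ℂ G W) : Representation ℂ G W where
  toFun g := (χ g : ℂ) • σ g
  map_one' := by simp
  map_mul' g h := by rw [map_mul, map_mul, Units.val_mul, smul_mul_smul_comm]

/-- The natural permutation representation of `GL_n(F)` on functions on `F^n`,
`(g f)(x) = f (g⁻¹ x)`. Up to a character, this is the restriction to `GL_n` of the oscillator
representation for the dual pair `(GL_n, GL_1)`. -/
def permRep (F : Type*) [Field F] (n : ℕ) :
    Representation ℂ (GL (Fin n) F) ((Fin n → F) → ℂ) where
  toFun g :=
    LinearMap.funLeft ℂ ℂ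
      (fun x : Fin n → F => ((g⁻¹ : GL (Fin n) F) : Matrix (Fin n) (Fin n) F).mulVec x)
  map_one' := by
    ext f x
    simp [LinearMap.funLeft_apply]
  map_mul' g h := by
    apply LinearMap.ext
    intro f
    funext x
    simp only [LinearMap.funLeft_apply, Module.End.mul_apply, mul_inv_rev, Units.val_mul,
      Matrix.mulVec_mulVec]

variable {F : Type*} [Field F] {n : ℕ} {V : Type*} [AddCommGroup V] [Module ℂ V]

/-- `ρ` (irreducible) has tensor rank at most `k`: it appears, up to a twist by a character, in an
`ℓ`-fold tensor product of irreducible components of the permutation representation on functions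
on `F^n`, for some `ℓ ≤ k`. -/
def TensorRankLE (ρ : Representation ℂ (GL (Fin n) F) V) (k : ℕ) : Prop :=
  ∃ ℓ ≤ k, ∃ σ : Fin ℓ → Subrepresentation (permRep F n),
    (∀ i, (σ i).toRepresentation.IsIrreducible) ∧
    ∃ (χ : GL (Fin n) F →* ℂˣ)
      (f : ρ.IntertwiningMap (twist χ (tensorFamily fun i => (σ i).toRepresentation))),
      Function.Injective f

/-- `ρ` has tensor rank `k`: `k` is the least number such that `ρ` has tensor rank at most `k`. -/
def HasTensorRank (ρ : Representation ℂ (GL (Fin n) F) V) (k : ℕ) : Prop :=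
  IsLeast {m : ℕ | TensorRankLE ρ m} k

end TensorRank

end GLRank

/-!
Write `L²(M_{n,r})` for the functions on `n × r` matrices, on which `GL_n` acts by left translation.
It is the `r`-fold tensor power of `L²(F^n)`, so an irreducible `ρ` has tensor rank at most `k` iff,
up to a twist by a character, it occurs in `L²(M_{n,r})` for some `r ≤ k` (`OccursIn.tensorRankLE`,
`TensorRankLE.occursIn`). Let `r` be the least number such that `ρ` occurs in `L²(M_{n,r})`; the
theorem says that `r = k`, the `U`-rank of `ρ`.

*The bound `k ≤ r`* (`rank_le_of_matRep_eigenvector`). Let the matrix subgroup act on `f` by the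
character `T ↦ χ₀ (tr (S T))`: then `f X` is multiplied by its inverse when `T Y` is added to some
rows of `X`, where `Y` consists of other rows of `X`. If `f X ≠ 0` and `w Y = 0`, the elements
`T = v w` fix `X`, which forces `w S = 0`. Hence the rank of `S` is at most the rank of `Y`, which
has only `r` columns. Twists do not matter here, since characters of `GL_n` are trivial on unipotent
elements when `n ≥ 3`.

*The bound `r ≤ 2 k`* (`HasURank.occursIn`). After conjugation, a character of rank `k` is
`T ↦ χ₀ (tr (S T))` on a `k × k` block, with `S` invertible. Split `F^n` into the first and second
blocks, of size `k`, and a third block of size `n - 2 k`. The space `charSpace` of vectors on which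
the rows of the first block act through `S` on the second block and trivially on the third one is
nonzero and stable under the block upper triangular matrices with identity matrices in the first two
diagonal blocks. A nontrivial character of a transvection of `GL_{n-2k}` in this space would produce
a character of rank `k + 1` of another matrix subgroup, so `SL_{n-2k}` acts trivially, and so do its
commutators with the unipotent part, which exhaust that part. An eigenvector of the commutative
quotient spans a line on which the stabilizer of the `n × 2k` matrix of the first `2k` basis vectors
acts by a character of `GL_n`, and Frobenius reciprocity embeds `ρ` into a twist of `L²(M_{n,2k})`.

*The bound `r ≤ k`* (`OccursIn.pred_or_lt`). As `2 r ≤ 4 k < n`, two blocks of `r` coordinates fit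
into `n`. Let `Q` be an equivariant projection of `L²(M_{n,r})` onto a twisted copy of `ρ`. The
commutant of `GL_n` is spanned by operators `relOp n K` attached to the spaces `K` of linear
relations between the columns of two matrices. If `K` is the graph of an invertible `C`, the
operator is the right translation by `C`; otherwise its image embeds equivariantly into
`L²(M_{n,r-1})`, by restriction to the matrices `Z D` for some fixed `D`
(`eq_graphRel_or_exists_factor`). There is a function `e` on which a matrix subgroup acts by a
character of rank `r`. If `Q e ≠ 0`, this character appears in `ρ` and `r ≤ k`. If `Q e = 0`, the
operators of the second kind kill `e` by the bound for `r - 1`, and the right translates of `e` are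
linearly independent; so `Q` involves only operators of the second kind, and `ρ` occurs in
`L²(M_{n,r-1})`, against the choice of `r`.
-/

open scoped Matrix

namespace GLRank

/-! ### Characters of matrix groups and eigenvectors -/

section Characters

/-- A nonzero invariant subspace contains a common eigenvector of a finite commutative group: by
Fourier inversion, `v` is a multiple of the sum over `ψ` of the vectors `∑ a, ψ (-a) • τ a v`. -/
theorem exists_character_eigenvector {A : Type*} [AddCommGroup A] [Finite A] {V : Type*}
    [AddCommGroup V] [Module ℂ V] (τ : A → V →ₗ[ℂ] V) (h0 : τ 0 = LinearMap.id)
    (hadd : ∀ a b, τ (a + b) = τ a ∘ₗ τ b) (W : Submodule ℂ V)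
    (hW : ∀ a, ∀ w ∈ W, τ a w ∈ W) {v : V} (hv : v ∈ W) (hv0 : v ≠ 0) :
    ∃ ψ : AddChar A ℂ, ∃ w ∈ W, w ≠ 0 ∧ ∀ a, τ a w = ψ a • w := by
  classical
  have := Fintype.ofFinite A
  have key : ∃ ψ : AddChar A ℂ, ∑ a, ψ (-a) • τ a v ≠ 0 := by
    by_contra! h
    have h1 : ∑ ψ : AddChar A ℂ, ∑ a, ψ (-a) • τ a v = 0 := Finset.sum_eq_zero fun ψ _ => h ψ
    rw [Finset.sum_comm] at h1
    simp_rw [← Finset.sum_smul, AddChar.sum_apply_eq_ite, neg_eq_zero, ite_smul, zero_smul] at h1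
    rw [Finset.sum_ite_eq' Finset.univ (0 : A)] at h1
    simp [h0, hv0] at h1
  obtain ⟨ψ, hψ⟩ := key
  refine ⟨ψ, _, W.sum_mem fun a _ => W.smul_mem _ (hW a v hv), hψ, fun b => ?_⟩
  rw [map_sum, Finset.smul_sum, ← Equiv.sum_comp (Equiv.addLeft b) fun a => ψ b • ψ (-a) • τ a v]
  refine Finset.sum_congr rfl fun a _ => ?_
  rw [map_smul, ← LinearMap.comp_apply, ← hadd, Equiv.coe_addLeft, smul_smul,
    ← AddChar.map_add_eq_mul]
  congr 2
  simp

/-- If `a` moves a vector of an invariant subspace, then a nontrivial character occurs there. -/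
theorem exists_nontrivial_character_eigenvector {A : Type*} [AddCommGroup A] [Finite A]
    {V : Type*} [AddCommGroup V] [Module ℂ V] (τ : A → V →ₗ[ℂ] V) (h0 : τ 0 = LinearMap.id)
    (hadd : ∀ a b, τ (a + b) = τ a ∘ₗ τ b) (W : Submodule ℂ V)
    (hW : ∀ a, ∀ w ∈ W, τ a w ∈ W) {v : V} (hv : v ∈ W) {a : A} (ha : τ a v ≠ v) :
    ∃ ψ : AddChar A ℂ, ψ ≠ 1 ∧ ∃ w ∈ W, w ≠ 0 ∧ ∀ a, τ a w = ψ a • w := by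
  classical
  have := Fintype.ofFinite A
  -- the vectors of `W` whose average over `A` vanishes
  let W' : Submodule ℂ V := W ⊓ LinearMap.ker (∑ b, τ b)
  have hτ : ∀ a, (∑ b, τ b) ∘ₗ τ a = ∑ b, τ b := fun a => by
    ext w
    conv_rhs => rw [← Equiv.sum_comp (Equiv.addRight a) τ]
    simp [hadd]
  have hτ' : ∀ a w, (∑ b, τ b) (τ a w) = (∑ b, τ b) w := fun a w => by
    rw [← LinearMap.comp_apply, hτ]
  obtain ⟨ψ, w, hw, hw0, hψ⟩ := exists_character_eigenvector τ h0 hadd W'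
    (fun b w hw => ⟨hW b w hw.1, by
      exact LinearMap.mem_ker.2 ((hτ' b w).trans (LinearMap.mem_ker.1 hw.2))⟩)
    (v := τ a v - v) ⟨W.sub_mem (hW a v hv) hv, LinearMap.mem_ker.2 <| by
      rw [map_sub, hτ', sub_self]⟩
    (sub_ne_zero.2 ha)
  refine ⟨ψ, ?_, w, hw.1, hw0, hψ⟩
  rintro rfl
  have h1 := LinearMap.mem_ker.1 hw.2
  rw [LinearMap.sum_apply] at h1
  simp [hψ, hw0, ← Nat.cast_smul_eq_nsmul ℂ] at h1

theorem eq_zero_of_addChar_mul_eq_one {F : Type*} [Field F] {χ₀ : AddChar F ℂ} (hχ₀ : χ₀ ≠ 1)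
    {x : F} (hx : ∀ c, χ₀ (c * x) = 1) : x = 0 := by
  by_contra h
  refine hχ₀ (DFunLike.ext _ _ fun y => ?_)
  simpa [h] using hx (y * x⁻¹)

theorem eq_zero_of_addChar_trace_eq_one {F : Type*} [Field F] {χ₀ : AddChar F ℂ} (hχ₀ : χ₀ ≠ 1)
    {α β : Type*} [Fintype α] [Fintype β] {S : Matrix β α F}
    (hS : ∀ T : Matrix α β F, χ₀ (Matrix.trace (S * T)) = 1) : S = 0 := by
  classical
  ext b a
  refine eq_zero_of_addChar_mul_eq_one hχ₀ fun c => ?_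
  have := hS (Matrix.single a b c)
  rw [Matrix.trace_mul_single] at this
  rwa [mul_comm]

/-- Every additive character of a space of matrices is given by the trace pairing with a matrix,
by counting characters. -/
theorem exists_eq_addChar_trace {F : Type*} [Field F] [Finite F] {χ₀ : AddChar F ℂ} (hχ₀ : χ₀ ≠ 1)
    {α β : Type*} [Fintype α] [Fintype β] (ψ : AddChar (Matrix α β F) ℂ) :
    ∃ S : Matrix β α F, ∀ T, ψ T = χ₀ (Matrix.trace (S * T)) := by
  classical
  have := Fintype.ofFinite F
  let Φ : Matrix β α F → AddChar (Matrix α β F) ℂ := fun S =>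
    { toFun := fun T => χ₀ (Matrix.trace (S * T))
      map_zero_eq_one' := by simp
      map_add_eq_mul' := fun T T' => by simp [Matrix.mul_add, AddChar.map_add_eq_mul] }
  have hinj : Function.Injective Φ := fun S S' h => by
    rw [← sub_eq_zero]
    refine eq_zero_of_addChar_trace_eq_one hχ₀ fun T => ?_
    have h1 : χ₀ (Matrix.trace (S * T)) = χ₀ (Matrix.trace (S' * T)) := DFunLike.congr_fun h T
    rw [Matrix.sub_mul, Matrix.trace_sub, AddChar.map_sub_eq_div, h1]
    refine div_self fun h0 => ?_
    have h2 := AddChar.map_add_eq_mul χ₀ (S' * T).trace (-(S' * T).trace)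
    simp [h0] at h2
  have hbij : Function.Bijective Φ := by
    rw [Fintype.bijective_iff_injective_and_card]
    refine ⟨hinj, ?_⟩
    rw [AddChar.card_eq]
    exact Fintype.card_congr (Matrix.transposeAddEquiv β α F).toEquiv
  obtain ⟨S, hS⟩ := hbij.2 ψ
  exact ⟨S, fun T => by rw [← hS]; rfl⟩

end Characters

/-! ### Splitting intertwining maps -/

section Intertwining

variable {G : Type*} [Group G] {V W : Type*} [AddCommGroup V] [Module ℂ V] [AddCommGroup W]
  [Module ℂ W]

@[simp]
theorem twist_apply (χ : G →* ℂˣ) (σ : Representation ℂ G W) (g : G) (w : W) :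
    twist χ σ g w = (χ g : ℂ) • σ g w := rfl

/-- Maschke's theorem, for a surjective intertwining map. -/
theorem exists_intertwining_section [Finite G] {ρ : Representation ℂ G V}
    {σ : Representation ℂ G W} (T : σ.IntertwiningMap ρ) (hT : Function.Surjective T) :
    ∃ s : ρ.IntertwiningMap σ, ∀ v, T (s v) = v := by
  have := Fintype.ofFinite G
  obtain ⟨s, hs⟩ := T.toLinearMap.exists_rightInverse_of_surjective (LinearMap.range_eq_top.2 hT)
  have hs' : ∀ v, T (s v) = v := fun v => LinearMap.congr_fun hs v
  refine ⟨LinearMap.intertwiningMap_of_isIntertwiningMap ρ σ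
    ((Fintype.card G : ℂ)⁻¹ • ∑ g, σ g ∘ₗ s ∘ₗ ρ g⁻¹) fun h v => ?_, fun v => ?_⟩
  · simp only [LinearMap.smul_apply, LinearMap.sum_apply, LinearMap.comp_apply, map_smul, map_sum]
    congr 1
    rw [← Equiv.sum_comp (Equiv.mulLeft h)]
    refine Finset.sum_congr rfl fun g _ => ?_
    simp [← Module.End.mul_apply, ← map_mul]
  · rw [LinearMap.toIntertwiningMap]
    simp only [LinearMap.smul_apply, LinearMap.sum_apply, LinearMap.comp_apply, map_smul, map_sum,
      T.isIntertwining, hs', Representation.self_inv_apply]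
    simp [← Nat.cast_smul_eq_nsmul ℂ]

/-- Maschke's theorem, for an injective intertwining map; neither representation needs to be
finite-dimensional. -/
theorem exists_intertwining_retraction [Finite G] {ρ : Representation ℂ G V}
    {σ : Representation ℂ G W} (f : ρ.IntertwiningMap σ) (hf : Function.Injective f) :
    ∃ T : σ.IntertwiningMap ρ, ∀ v, T (f v) = v := by
  have := Fintype.ofFinite G
  obtain ⟨p, hp⟩ := f.toLinearMap.exists_leftInverse_of_injective (LinearMap.ker_eq_bot.2 hf)
  have hp' : ∀ v, p (f v) = v := fun v => LinearMap.congr_fun hp v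
  refine ⟨LinearMap.intertwiningMap_of_isIntertwiningMap σ ρ
    ((Fintype.card G : ℂ)⁻¹ • ∑ g, ρ g ∘ₗ p ∘ₗ σ g⁻¹) fun h v => ?_, fun v => ?_⟩
  · simp only [LinearMap.smul_apply, LinearMap.sum_apply, LinearMap.comp_apply, map_smul, map_sum]
    congr 1
    rw [← Equiv.sum_comp (Equiv.mulLeft h)]
    refine Finset.sum_congr rfl fun g _ => ?_
    simp [← Module.End.mul_apply, ← map_mul]
  · rw [LinearMap.toIntertwiningMap]
    simp only [LinearMap.smul_apply, LinearMap.sum_apply, LinearMap.comp_apply,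
      ← f.isIntertwining, hp', Representation.self_inv_apply]
    simp [← Nat.cast_smul_eq_nsmul ℂ]

end Intertwining

/-! ### Functions on matrices -/

section MatRep

/-- The representation of `GL_n(F)` on functions on the space of `n × ι` matrices,
`(g f)(X) = f (g⁻¹ X)`. -/
def matRep (F : Type*) [Field F] (n : ℕ) (ι : Type*) [Fintype ι] :
    Representation ℂ (GL (Fin n) F) (Matrix (Fin n) ι F → ℂ) where
  toFun g := LinearMap.funLeft ℂ ℂ fun X => ((g⁻¹ : GL (Fin n) F) : Matrix (Fin n) (Fin n) F) * X
  map_one' := by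
    ext f x
    simp [LinearMap.funLeft_apply]
  map_mul' g h := by
    apply LinearMap.ext
    intro f
    funext x
    simp only [LinearMap.funLeft_apply, Module.End.mul_apply, mul_inv_rev, Units.val_mul,
      Matrix.mul_assoc]

variable {F : Type*} [Field F] {n : ℕ} {ι : Type*} [Fintype ι]
  {V : Type*} [AddCommGroup V] [Module ℂ V]

theorem matRep_apply (g : GL (Fin n) F) (f : Matrix (Fin n) ι F → ℂ) (X : Matrix (Fin n) ι F) :
    matRep F n ι g f X = f (((g⁻¹ : GL (Fin n) F) : Matrix (Fin n) (Fin n) F) * X) := rfl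

/-- Up to a twist by a character, `ρ` embeds into the functions on `n × ι` matrices. -/
def OccursIn (ι : Type*) [Fintype ι] (ρ : Representation ℂ (GL (Fin n) F) V) : Prop :=
  ∃ (χ : GL (Fin n) F →* ℂˣ) (f : ρ.IntertwiningMap (twist χ (matRep F n ι))),
    Function.Injective f

theorem OccursIn.reindex {κ : Type*} [Fintype κ] (e : ι ≃ κ)
    {ρ : Representation ℂ (GL (Fin n) F) V} (h : OccursIn ι ρ) : OccursIn κ ρ := by
  obtain ⟨χ, f, hf⟩ := h
  refine ⟨χ, LinearMap.intertwiningMap_of_isIntertwiningMap ρ (twist χ (matRep F n κ))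
    (LinearMap.funLeft ℂ ℂ (fun X : Matrix (Fin n) κ F => X.submatrix id e) ∘ₗ f.toLinearMap)
    (fun g v => ?_), fun v w h => hf (funext fun X => ?_)⟩
  · funext X
    simp only [LinearMap.comp_apply, LinearMap.funLeft_apply,
      Representation.IntertwiningMap.coe_toLinearMap, f.isIntertwining, twist_apply, Pi.smul_apply,
      matRep_apply]
    rfl
  · simpa using congr_fun h (X.submatrix id e.symm)

/-- Frobenius reciprocity for the orbit of `X₀`: a vector on which the stabilizer of `X₀` acts by
the restriction of a character of `GL_n` embeds `ρ` into a twist of the functions on matrices. -/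
theorem occursIn_of_stabilizer [Finite F] {ρ : Representation ℂ (GL (Fin n) F) V}
    [hρ : ρ.IsIrreducible] (χ : GL (Fin n) F →* ℂˣ) (X₀ : Matrix (Fin n) ι F) {v : V} (hv : v ≠ 0)
    (h : ∀ g : GL (Fin n) F, (g : Matrix (Fin n) (Fin n) F) * X₀ = X₀ → ρ g v = (χ g : ℂ) • v) :
    OccursIn ι ρ := by
  classical
  have := Fintype.ofFinite F
  let T₀ : (Matrix (Fin n) ι F → ℂ) →ₗ[ℂ] V :=
    { toFun := fun f => ∑ g : GL (Fin n) F, ((χ g : ℂ)⁻¹ *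
        f ((g : Matrix (Fin n) (Fin n) F) * X₀)) • ρ g v
      map_add' := fun f f' => by simp [mul_add, add_smul, Finset.sum_add_distrib]
      map_smul' := fun c f => by
        rw [Finset.smul_sum]
        refine Finset.sum_congr rfl fun g _ => ?_
        simp only [Pi.smul_apply, smul_eq_mul, RingHom.id_apply, smul_smul]
        congr 1
        ring }
  have hT₀ : ∀ (h : GL (Fin n) F) (f : Matrix (Fin n) ι F → ℂ),
      T₀ (twist χ (matRep F n ι) h f) = ρ h (T₀ f) := fun h f => by
    simp only [T₀, LinearMap.coe_mk, AddHom.coe_mk, map_sum, map_smul]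
    rw [← Equiv.sum_comp (Equiv.mulLeft h)]
    refine Finset.sum_congr rfl fun g _ => ?_
    simp only [twist_apply, Pi.smul_apply, matRep_apply, Equiv.coe_mulLeft, Units.val_mul,
      ← Matrix.mul_assoc, Units.inv_mul, Matrix.one_mul, map_mul, Module.End.mul_apply,
      smul_eq_mul]
    congr 1
    field_simp
  let T : (twist χ (matRep F n ι)).IntertwiningMap ρ :=
    T₀.intertwiningMap_of_isIntertwiningMap _ ρ hT₀
  have hT : ∀ f, T f = ∑ g : GL (Fin n) F, ((χ g : ℂ)⁻¹ *
      f ((g : Matrix (Fin n) (Fin n) F) * X₀)) • ρ g v := fun f => rfl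
  have hT0 : T ≠ 0 := by
    intro h0
    have h1 := hT (Pi.single X₀ 1)
    rw [h0, Finset.sum_congr rfl (g := fun g : GL (Fin n) F =>
      if (g : Matrix (Fin n) (Fin n) F) * X₀ = X₀ then v else 0)] at h1
    · rw [← Finset.sum_filter, Finset.sum_const, ← Nat.cast_smul_eq_nsmul ℂ] at h1
      have h2 := h1.symm
      rw [Representation.IntertwiningMap.coe_zero, Pi.zero_apply, smul_eq_zero, or_iff_left hv,
        Nat.cast_eq_zero, Finset.card_eq_zero] at h2
      have : (1 : GL (Fin n) F) ∈ (∅ : Finset (GL (Fin n) F)) := by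
        rw [← h2]; simp
      simp at this
    · intro g _
      by_cases hg : (g : Matrix (Fin n) (Fin n) F) * X₀ = X₀
      · simp [hg, h g hg, smul_smul]
      · simp [hg]
  have hsurj := (Representation.IsIrreducible.surjective_or_eq_zero T).resolve_right hT0
  obtain ⟨s, hs⟩ := exists_intertwining_section T hsurj
  exact ⟨χ, s, fun v w h => by rw [← hs v, h, hs w]⟩

end MatRep

/-! ### Decomposition into irreducible subrepresentations -/

section Semisimple

variable {G : Type*} [Group G] {W : Type*} [AddCommGroup W] [Module ℂ W]

/-- The inclusion of a subrepresentation, as an intertwining map. -/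
def subrepIncl {σ : Representation ℂ G W} (S : Subrepresentation σ) :
    S.toRepresentation.IntertwiningMap σ :=
  S.toSubmodule.subtype.intertwiningMap_of_isIntertwiningMap _ _ fun _ _ => rfl

@[simp]
theorem subrepIncl_apply {σ : Representation ℂ G W} (S : Subrepresentation σ) (w : S.toSubmodule) :
    subrepIncl S w = w := rfl

theorem isIrreducible_of_isAtom {σ : Representation ℂ G W} {S : Subrepresentation σ}
    (hS : IsAtom S) : S.toRepresentation.IsIrreducible := by
  have hne : S.toSubmodule ≠ ⊥ := fun h => hS.1 (Subrepresentation.toSubmodule_injective h)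
  obtain ⟨w, hw, hw0⟩ := Submodule.exists_mem_ne_zero_of_ne_bot hne
  refine { exists_pair_ne := ⟨⊥, ⊤, fun h => hw0 ?_⟩, eq_bot_or_eq_top := fun N => ?_ }
  · have h1 : (⟨w, hw⟩ : S.toSubmodule) ∈
        (⊥ : Subrepresentation S.toRepresentation).toSubmodule := by
      rw [h]; exact Submodule.mem_top
    simpa using (Submodule.mem_bot ℂ).1 h1
  · let N' : Subrepresentation σ :=
      { toSubmodule := N.toSubmodule.map S.toSubmodule.subtype
        apply_mem_toSubmodule := by
          rintro g _ ⟨x, hx, rfl⟩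
          exact ⟨S.toRepresentation g x, N.apply_mem_toSubmodule g hx, rfl⟩ }
    have hle : N' ≤ S := by
      rintro _ ⟨x, -, rfl⟩
      exact x.2
    rcases hS.le_iff.1 hle with h | h
    · left
      apply Subrepresentation.toSubmodule_injective
      have h1 : N.toSubmodule.map S.toSubmodule.subtype = ⊥ := congr_arg (·.toSubmodule) h
      exact Submodule.map_injective_of_injective S.toSubmodule.subtype_injective
        (h1.trans (Submodule.map_bot _).symm)
    · right
      apply Subrepresentation.toSubmodule_injective
      have h1 : N.toSubmodule.map S.toSubmodule.subtype = S.toSubmodule :=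
        congr_arg (·.toSubmodule) h
      refine eq_top_iff.2 fun x _ => ?_
      obtain ⟨y, hy, hyx⟩ := h1.ge x.2
      rwa [← Subtype.ext hyx]

/-- A finite-dimensional representation of a finite group is a finite sum of images of projections
onto irreducible subrepresentations. -/
theorem exists_irreducible_decomposition [Finite G] [FiniteDimensional ℂ W]
    (σ : Representation ℂ G W) :
    ∃ (A : Type) (_ : Fintype A) (S : A → Subrepresentation σ)
      (p : ∀ a, σ.IntertwiningMap (S a).toRepresentation),
      (∀ a, (S a).toRepresentation.IsIrreducible) ∧ ∀ w, ∑ a, (p a w : W) = w := by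
  let Good : Subrepresentation σ → Prop := fun M =>
    ∃ (A : Type) (_ : Fintype A) (S : A → Subrepresentation σ)
      (p : ∀ a, σ.IntertwiningMap (S a).toRepresentation),
      (∀ a, (S a).toRepresentation.IsIrreducible) ∧ ∀ w ∈ M, ∑ a, (p a w : W) = w
  have hmono : StrictMono (fun M : Subrepresentation σ => M.toSubmodule) := fun M N h => h
  have : WellFoundedGT (Subrepresentation σ) := hmono.wellFoundedGT
  have : WellFoundedLT (Subrepresentation σ) := hmono.wellFoundedLT
  obtain ⟨M, hM, hmax⟩ := WellFounded.has_min (wellFounded_gt (α := Subrepresentation σ))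
    {M | Good M} ⟨⊥, Empty, inferInstance, Empty.elim, Empty.rec, fun a => a.elim, fun w hw => by
      simpa using ((Submodule.mem_bot ℂ).1 hw).symm⟩
  by_cases htop : M = ⊤
  · subst htop
    obtain ⟨A, hA, S, p, hS, hp⟩ := hM
    exact ⟨A, hA, S, p, hS, fun w => hp w Submodule.mem_top⟩
  exfalso
  obtain ⟨pM, hpM⟩ := exists_intertwining_retraction (subrepIncl M) Subtype.val_injective
  have hbot : pM.ker ≠ ⊥ := by
    intro h
    apply htop
    apply Subrepresentation.toSubmodule_injective
    refine eq_top_iff.2 fun w _ => ?_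
    have h1 : w - pM w ∈ pM.ker := by
      rw [Representation.IntertwiningMap.mem_ker, map_sub, sub_eq_zero]
      exact (hpM (pM w)).symm
    rw [h] at h1
    have h2 : w - pM w = 0 := (Submodule.mem_bot ℂ).1 h1
    rw [sub_eq_zero.1 h2]
    exact (pM w).2
  have : IsAtomic (Subrepresentation σ) := isAtomic_of_orderBot_wellFounded_lt wellFounded_lt
  -- a maximal `M` that decomposes could be enlarged by a minimal `τ` in a complement of `M`
  obtain ⟨τ, hτ, hτM⟩ := (eq_bot_or_exists_atom_le pM.ker).resolve_left hbot
  obtain ⟨r, hr⟩ := exists_intertwining_retraction (subrepIncl τ) Subtype.val_injective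
  let r' : σ.IntertwiningMap τ.toRepresentation :=
    r.comp (Representation.IntertwiningMap.id σ - (subrepIncl M).comp pM)
  have hr' : ∀ w, r' w = r (w - pM w) := fun w => rfl
  have hr'M : ∀ w ∈ M, r' w = 0 := fun w hw => by
    have := hpM ⟨w, hw⟩
    rw [subrepIncl_apply] at this
    rw [hr', this, sub_self, map_zero]
  have hr'τ : ∀ w ∈ τ, (r' w : W) = w := fun w hw => by
    have h1 : pM w = 0 := hτM hw
    have h2 := hr ⟨w, hw⟩
    rw [subrepIncl_apply] at h2
    rw [hr', h1, Submodule.coe_zero, sub_zero, h2]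
  obtain ⟨A, hA, S, p, hS, hp⟩ := hM
  refine hmax (M ⊔ τ) ⟨Option A, inferInstance, fun o => o.elim τ S,
    fun o => match o with
      | none => r'
      | some a => (p a).comp (Representation.IntertwiningMap.id σ - (subrepIncl τ).comp r'),
    fun o => match o with
      | none => isIrreducible_of_isAtom hτ
      | some a => hS a, fun w hw => ?_⟩ (lt_of_le_of_ne le_sup_left fun h => ?_)
  · obtain ⟨x, hx, y, hy, rfl⟩ := Submodule.mem_sup.1 hw
    have hxy : (r' (x + y) : W) = y := by
      rw [map_add, hr'M x hx, zero_add, hr'τ y hy]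
    have h1 : ∀ a, ((p a).comp (Representation.IntertwiningMap.id σ - (subrepIncl τ).comp r'))
        (x + y) = p a x := fun a => by
      change p a (x + y - (r' (x + y) : W)) = _
      rw [hxy, add_sub_cancel_right]
    rw [Fintype.sum_option]
    refine (congr_arg₂ (· + ·) hxy ((Finset.sum_congr rfl fun a _ =>
      congr_arg Subtype.val (h1 a)).trans (hp x hx))).trans (add_comm _ _)
  · have hle : τ ≤ M := h ▸ le_sup_right
    apply hτ.1
    apply Subrepresentation.toSubmodule_injective
    refine eq_bot_iff.2 fun w hw => (Submodule.mem_bot ℂ).2 ?_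
    have h1 := hr'τ w hw
    rw [hr'M w (hle hw)] at h1
    exact h1.symm

end Semisimple

/-! ### Tensor rank and functions on matrices -/

section Tensor

variable {F : Type*} [Field F] {n : ℕ}

/-- The tensor product of `ℓ` copies of the functions on `F^n` is the space of functions on
`n × ℓ` matrices: a pure tensor goes to the product of its factors, evaluated at the columns. -/
noncomputable def tensorEquiv (F : Type*) [Field F] [Finite F] (n ℓ : ℕ) :
    (⨂[ℂ] _ : Fin ℓ, ((Fin n → F) → ℂ)) ≃ₗ[ℂ] (Matrix (Fin n) (Fin ℓ) F → ℂ) :=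
  (Basis.piTensorProduct fun _ : Fin ℓ => Pi.basisFun ℂ (Fin n → F)).equivFun ≪≫ₗ
    LinearEquiv.funCongrLeft ℂ ℂ (Matrix.transposeAddEquiv (Fin n) (Fin ℓ) F).toEquiv

theorem tensorEquiv_tprod [Finite F] (ℓ : ℕ) (x : Fin ℓ → (Fin n → F) → ℂ)
    (X : Matrix (Fin n) (Fin ℓ) F) :
    tensorEquiv F n ℓ (PiTensorProduct.tprod ℂ x) X = ∏ i, x i (Xᵀ i) := by
  refine (Basis.piTensorProduct_repr_tprod_apply
    (fun _ : Fin ℓ => Pi.basisFun ℂ (Fin n → F)) x fun i => Xᵀ i).trans ?_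
  simp

theorem tensorEquiv_tensorFamily [Finite F] (ℓ : ℕ) (g : GL (Fin n) F)
    (t : ⨂[ℂ] _ : Fin ℓ, ((Fin n → F) → ℂ)) :
    tensorEquiv F n ℓ (tensorFamily (fun _ => permRep F n) g t) =
      matRep F n (Fin ℓ) g (tensorEquiv F n ℓ t) := by
  refine LinearMap.congr_fun (f := (tensorEquiv F n ℓ).toLinearMap ∘ₗ
      tensorFamily (fun _ => permRep F n) g)
    (g := matRep F n (Fin ℓ) g ∘ₗ (tensorEquiv F n ℓ).toLinearMap) ?_ t
  refine PiTensorProduct.ext (MultilinearMap.ext fun x => funext fun X => ?_)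
  simp only [LinearMap.compMultilinearMap_apply, LinearMap.comp_apply, LinearEquiv.coe_coe,
    matRep_apply, tensorEquiv_tprod]
  erw [PiTensorProduct.map_tprod, tensorEquiv_tprod]
  rfl

variable {V : Type*} [AddCommGroup V] [Module ℂ V]

/-- Decomposing each tensor factor `L²(F^n)` into irreducible components, one of the resulting
projections is nonzero, hence injective, on the copy of `ρ`. -/
theorem OccursIn.tensorRankLE [Finite F] {ρ : Representation ℂ (GL (Fin n) F) V}
    [hρ : ρ.IsIrreducible] {ℓ : ℕ} (h : OccursIn (Fin ℓ) ρ) : TensorRankLE ρ ℓ := by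
  classical
  obtain ⟨χ, f, hf⟩ := h
  obtain ⟨A, hA, S, p, hS, hp⟩ := exists_irreducible_decomposition (permRep F n)
  have hid : ∀ t : ⨂[ℂ] _ : Fin ℓ, ((Fin n → F) → ℂ), ∑ a : Fin ℓ → A,
      PiTensorProduct.map (fun i => (subrepIncl (S (a i))).toLinearMap ∘ₗ
        (p (a i)).toLinearMap) t = t := fun t => by
    have h1 := (PiTensorProduct.mapMultilinear ℂ (fun _ : Fin ℓ => (Fin n → F) → ℂ)
      (fun _ : Fin ℓ => (Fin n → F) → ℂ)).map_sum
      (fun (_ : Fin ℓ) (a : A) => (subrepIncl (S a)).toLinearMap ∘ₗ (p a).toLinearMap)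
    have h2 : ∑ a, (subrepIncl (S a)).toLinearMap ∘ₗ (p a).toLinearMap = LinearMap.id := by
      refine LinearMap.ext fun w => ?_
      rw [LinearMap.sum_apply]
      exact hp w
    simp only [h2, PiTensorProduct.mapMultilinear_apply, PiTensorProduct.map_id] at h1
    have h3 := LinearMap.congr_fun h1 t
    rw [LinearMap.sum_apply] at h3
    exact h3.symm
  have : Nontrivial V := by
    by_contra hV
    rw [not_nontrivial_iff_subsingleton] at hV
    exact bot_ne_top (α := Subrepresentation ρ)
      (Subrepresentation.toSubmodule_injective (Subsingleton.elim _ _))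
  obtain ⟨v, hv⟩ := exists_ne (0 : V)
  have hw : (tensorEquiv F n ℓ).symm (f v) ≠ 0 := by
    rw [Ne, LinearEquiv.map_eq_zero_iff, ← map_zero f]
    exact fun h => hv (hf h)
  obtain ⟨a, -, ha⟩ := Finset.exists_ne_zero_of_sum_ne_zero ((hid _).trans_ne hw)
  refine ⟨ℓ, le_rfl, fun i => S (a i), fun i => hS _, χ, ?_⟩
  let q : V →ₗ[ℂ] ⨂[ℂ] i : Fin ℓ, (S (a i)).toSubmodule :=
    PiTensorProduct.map (fun i => (p (a i)).toLinearMap) ∘ₗ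
      (tensorEquiv F n ℓ).symm.toLinearMap ∘ₗ f.toLinearMap
  have hq : ∀ (g : GL (Fin n) F) (v : V), q (ρ g v) =
      twist χ (tensorFamily fun i => (S (a i)).toRepresentation) g (q v) := fun g v => by
    simp only [q, LinearMap.comp_apply, Representation.IntertwiningMap.coe_toLinearMap,
      f.isIntertwining, twist_apply, map_smul, LinearEquiv.coe_coe]
    congr 1
    obtain ⟨t, ht⟩ := (tensorEquiv F n ℓ).surjective (f v)
    rw [← ht, ← tensorEquiv_tensorFamily, LinearEquiv.symm_apply_apply,
      LinearEquiv.symm_apply_apply]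
    refine LinearMap.congr_fun ((PiTensorProduct.map_comp _ _).symm.trans
      ((congr_arg PiTensorProduct.map (funext fun i => ?_)).trans
        (PiTensorProduct.map_comp _ _))) t
    exact (p (a i)).isIntertwining' g
  let Q := q.intertwiningMap_of_isIntertwiningMap ρ
    (twist χ (tensorFamily fun i => (S (a i)).toRepresentation)) hq
  refine ⟨Q, (Representation.IsIrreducible.injective_or_eq_zero Q).resolve_right fun h0 => ha ?_⟩
  rw [PiTensorProduct.map_comp, LinearMap.comp_apply]
  have h1 : q v = 0 := by
    change Q v = 0
    rw [h0]; rfl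
  exact (congr_arg _ h1).trans (map_zero _)

theorem TensorRankLE.occursIn [Finite F] {ρ : Representation ℂ (GL (Fin n) F) V} {m : ℕ}
    (h : TensorRankLE ρ m) : ∃ ℓ ≤ m, OccursIn (Fin ℓ) ρ := by
  obtain ⟨ℓ, hℓ, σ, -, χ, f, hf⟩ := h
  refine ⟨ℓ, hℓ, χ, ?_⟩
  choose p hp using fun i => (σ i).toSubmodule.subtype.exists_leftInverse_of_injective
    (LinearMap.ker_eq_bot.2 (σ i).toSubmodule.subtype_injective)
  let j : (⨂[ℂ] i, (σ i).toSubmodule) →ₗ[ℂ] ⨂[ℂ] _ : Fin ℓ, ((Fin n → F) → ℂ) :=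
    PiTensorProduct.map fun i => (σ i).toSubmodule.subtype
  have hj : Function.Injective j := by
    refine Function.LeftInverse.injective (g := PiTensorProduct.map p) fun t => ?_
    rw [← LinearMap.comp_apply, ← PiTensorProduct.map_comp]
    simp only [hp, PiTensorProduct.map_id, LinearMap.id_apply]
  refine ⟨((tensorEquiv F n ℓ).toLinearMap ∘ₗ j ∘ₗ
    f.toLinearMap).intertwiningMap_of_isIntertwiningMap ρ _ fun g v => ?_,
    fun v w h => hf (hj ((tensorEquiv F n ℓ).injective h))⟩
  simp only [LinearMap.comp_apply, Representation.IntertwiningMap.coe_toLinearMap,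
    f.isIntertwining, twist_apply, map_smul, LinearEquiv.coe_coe, ← tensorEquiv_tensorFamily]
  congr 2
  exact LinearMap.congr_fun ((PiTensorProduct.map_comp (fun i => (σ i).toSubmodule.subtype)
    fun i => (σ i).toRepresentation g).symm.trans
    (PiTensorProduct.map_comp (fun _ => permRep F n g) fun i => (σ i).toSubmodule.subtype)) (f v)

end Tensor

/-! ### Coordinate inclusions -/

section Selection

variable {F : Type*} [Field F] {ν α β : Type*} [DecidableEq ν]

/-- The matrix whose columns are the standard basis vectors indexed by the values of `r`. -/
def sel (F : Type*) [Field F] (r : α → ν) : Matrix ν α F := (1 : Matrix ν ν F).submatrix id r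

theorem sel_mul_sel {μ : Type*} [Fintype μ] [DecidableEq μ] (f : μ → ν) (r : α → μ) :
    sel F f * sel F r = sel F (f ∘ r) := by
  ext a b
  simp [sel, Matrix.mul_apply, Matrix.one_apply]

theorem sel_mul_single_mul_sel_transpose [DecidableEq α] [DecidableEq β] [Fintype α] [Fintype β]
    (r : α → ν) (c : β → ν) (a : α) (b : β) (t : F) :
    sel F r * Matrix.single a b t * (sel F c)ᵀ = Matrix.single (r a) (c b) t := by
  ext i j
  simp [sel, Matrix.mul_apply, Matrix.single_apply, Matrix.one_apply, ite_and, eq_comm]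
  rw [Finset.sum_eq_single b (fun x _ hx => by simp [hx.symm]) (by simp)]
  simp only [if_true]
  split_ifs <;> rfl

variable [Fintype ν]

theorem sel_transpose_mul_sel (r : α → ν) (c : β → ν) :
    (sel F r)ᵀ * sel F c = (1 : Matrix ν ν F).submatrix r c := by
  ext a b
  simp [sel, Matrix.mul_apply, Matrix.one_apply]

theorem sel_transpose_mul_sel_self [DecidableEq α] {r : α → ν} (hr : Function.Injective r) :
    (sel F r)ᵀ * sel F r = 1 := by
  rw [sel_transpose_mul_sel]
  ext a b
  simp [Matrix.one_apply, hr.eq_iff]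

theorem sel_transpose_mul_sel_of_ne {r : α → ν} {c : β → ν} (h : ∀ a b, r a ≠ c b) :
    (sel F r)ᵀ * sel F c = 0 := by
  rw [sel_transpose_mul_sel]
  ext a b
  simp [h]

theorem sel_mul_transpose_mul_self [Fintype α] [Fintype β] {r : α → ν} {c : β → ν}
    (h : ∀ a b, r a ≠ c b) (T T' : Matrix α β F) :
    sel F r * T * (sel F c)ᵀ * (sel F r * T' * (sel F c)ᵀ) = 0 := by
  have h1 : (sel F c)ᵀ * sel F r = 0 := sel_transpose_mul_sel_of_ne fun b a => (h a b).symm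
  calc _ = sel F r * T * ((sel F c)ᵀ * sel F r) * T' * (sel F c)ᵀ := by
        simp only [Matrix.mul_assoc]
    _ = 0 := by simp [h1]

/-- The invertible matrix `1 + M`, for `M` of square zero. -/
def oneAdd (M : Matrix ν ν F) (h : M * M = 0) : GL ν F where
  val := 1 + M
  inv := 1 - M
  val_inv := by simp [mul_sub, add_mul, h]
  inv_val := by simp [mul_add, sub_mul, h]

@[simp]
theorem coe_oneAdd (M : Matrix ν ν F) (h : M * M = 0) : (oneAdd M h : Matrix ν ν F) = 1 + M := rfl

@[simp]
theorem coe_inv_oneAdd (M : Matrix ν ν F) (h : M * M = 0) :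
    (((oneAdd M h)⁻¹ : GL ν F) : Matrix ν ν F) = 1 - M := rfl

theorem StandardBlock.place_eq {n a b : ℕ} (B : StandardBlock n a b)
    (T : Matrix (Fin a) (Fin b) F) :
    B.place T = sel F B.rowIdx * T * (sel F B.colIdx)ᵀ := by
  simp [place, sel, Matrix.transpose_submatrix]

end Selection

/-! ### Characters of `GL_n` on unipotent elements -/

section CharactersOfGL

variable {F : Type*} [Field F] {n : ℕ}

/-- A transvection is a commutator as soon as there is a third coordinate. -/
theorem character_transvection {A : Type*} [CommGroup A] (hn : 3 ≤ n) (χ : GL (Fin n) F →* A)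
    {i j : Fin n} (hij : i ≠ j) (t : F) {g : GL (Fin n) F}
    (hg : (g : Matrix (Fin n) (Fin n) F) = 1 + Matrix.single i j t) : χ g = 1 := by
  obtain ⟨l, hl⟩ : ∃ l, l ∉ ({i, j} : Finset (Fin n)) := by
    by_contra! h
    have h1 : (Finset.univ : Finset (Fin n)) ⊆ {i, j} := fun x _ => h x
    have h2 := (Finset.card_le_card h1).trans Finset.card_le_two
    rw [Finset.card_univ, Fintype.card_fin] at h2
    omega
  simp only [Finset.mem_insert, Finset.mem_singleton, not_or] at hl
  have h1 : Matrix.single i l t * Matrix.single i l t = (0 : Matrix (Fin n) (Fin n) F) := by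
    simp [hl.1]
  have h2 : Matrix.single l j 1 * Matrix.single l j 1 = (0 : Matrix (Fin n) (Fin n) F) := by
    simp [Ne.symm hl.2]
  have h3 : oneAdd _ h1 * oneAdd _ h2 = g * oneAdd _ h2 * oneAdd _ h1 := by
    ext1
    simp [hg, mul_add, add_mul, hij.symm, Ne.symm hl.2]
    abel
  have h4 := congr_arg χ h3
  simp only [map_mul] at h4
  rw [mul_assoc, mul_comm (χ (oneAdd _ h2)), eq_comm, mul_eq_right] at h4
  exact h4

theorem character_unipotent {A : Type*} [CommGroup A] (hn : 3 ≤ n) (χ : GL (Fin n) F →* A)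
    {α β : Type*} [Fintype α] [Fintype β] {r : α → Fin n} {c : β → Fin n}
    (h : ∀ a b, r a ≠ c b) (T : Matrix α β F) :
    χ (oneAdd (sel F r * T * (sel F c)ᵀ) (sel_mul_transpose_mul_self h T T)) = 1 := by
  classical
  induction T using Matrix.induction_on' with
  | h_zero =>
    rw [← map_one χ]
    congr 1
    ext1
    simp
  | h_add T T' hT hT' =>
    rw [← mul_one (1 : A)]
    refine Eq.trans ?_ (congr_arg₂ (· * ·) hT hT')
    rw [← map_mul]
    congr 1
    ext1
    have := sel_mul_transpose_mul_self (F := F) h T T'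
    simp only [coe_oneAdd, Units.val_mul, add_mul, mul_add, one_mul, mul_one, this,
      Matrix.mul_add, Matrix.add_mul]
    abel
  | h_std_basis a b t =>
    refine character_transvection hn χ (h a b) t ?_
    rw [coe_oneAdd, sel_mul_single_mul_sel_transpose]

end CharactersOfGL

/-! ### Rank of the characters in functions on matrices -/

theorem exists_perm_extending {X Y : Type*} [Finite Y] {f g : X → Y}
    (hf : Function.Injective f) (hg : Function.Injective g) :
    ∃ σ : Equiv.Perm Y, ∀ x, σ (f x) = g x := by
  classical
  refine ⟨((Equiv.ofInjective f hf).symm.trans (Equiv.ofInjective g hg)).extendSubtype,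
    fun x => ?_⟩
  rw [Equiv.extendSubtype_apply_of_mem _ _ (Set.mem_range_self x)]
  have : (⟨f x, Set.mem_range_self x⟩ : Set.range f) = Equiv.ofInjective f hf x := rfl
  erw [Equiv.trans_apply, this, Equiv.symm_apply_apply]
  rfl

section RankBound

variable {F : Type*} [Field F] {n : ℕ} {α β ι : Type*} [Fintype α] [Fintype β] [Fintype ι]

theorem rank_le_of_vecMul_eq_zero {Y : Matrix β ι F} {S : Matrix β α F}
    (h : ∀ w : β → F, w ᵥ* Y = 0 → w ᵥ* S = 0) : S.rank ≤ Fintype.card ι := by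
  classical
  have hle : LinearMap.ker Yᵀ.mulVecLin ≤ LinearMap.ker Sᵀ.mulVecLin := fun w hw => by
    rw [LinearMap.mem_ker, Matrix.mulVecLin_apply, Matrix.mulVec_transpose] at hw ⊢
    exact h w hw
  have h1 := Submodule.finrank_mono hle
  have h2 := LinearMap.finrank_range_add_finrank_ker Yᵀ.mulVecLin
  have h3 := LinearMap.finrank_range_add_finrank_ker Sᵀ.mulVecLin
  have h4 := Yᵀ.rank_le_card_height
  rw [← Matrix.rank_transpose]
  unfold Matrix.rank at h4 ⊢
  omega

/-- The characters of a matrix subgroup that appear in the functions on `n × ι` matrices have rank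
at most `|ι|`. -/
theorem rank_le_of_matRep_eigenvector {χ₀ : AddChar F ℂ} (hχ₀ : χ₀ ≠ 1) {r : α → Fin n}
    {c : β → Fin n} (h : ∀ a b, r a ≠ c b) {S : Matrix β α F} {f : Matrix (Fin n) ι F → ℂ}
    (hf : f ≠ 0)
    (hS : ∀ T,
      matRep F n ι (oneAdd (sel F r * T * (sel F c)ᵀ) (sel_mul_transpose_mul_self h T T)) f =
        χ₀ (S * T).trace • f) : S.rank ≤ Fintype.card ι := by
  obtain ⟨X, hX⟩ := Function.ne_iff.1 hf
  refine rank_le_of_vecMul_eq_zero (Y := (sel F c)ᵀ * X) fun w hw => funext fun a => ?_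
  classical
  refine eq_zero_of_addChar_mul_eq_one hχ₀ fun t => ?_
  have h1 := congr_fun (hS (Matrix.vecMulVec (Pi.single a t) w)) X
  have h2 : sel F r * Matrix.vecMulVec (Pi.single a t) w * (sel F c)ᵀ * X = 0 := by
    rw [Matrix.mul_assoc, Matrix.mul_assoc, Matrix.vecMulVec_mul, hw]
    ext
    simp [Matrix.vecMulVec, Matrix.mul_apply]
  rw [matRep_apply, coe_inv_oneAdd, Matrix.sub_mul, h2, Matrix.one_mul, sub_zero,
    Pi.smul_apply, smul_eq_mul, eq_comm, mul_eq_right₀ hX, Matrix.mul_vecMulVec,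
    Matrix.trace_vecMulVec] at h1
  rw [← h1]
  congr 1
  simp [Matrix.mulVec_single, dotProduct, Matrix.vecMul, Finset.mul_sum, mul_comm, mul_left_comm]

variable {V : Type*} [AddCommGroup V] [Module ℂ V]

/-- The `U`-rank bounds the rank of the characters that appear in the restriction to any matrix
subgroup with disjoint sets of rows and columns, standard or not: such a subgroup is conjugate
to a standard one by a permutation matrix. -/
theorem HasURank.rank_le {χ₀ : AddChar F ℂ} {ρ : Representation ℂ (GL (Fin n) F) V} {k : ℕ}
    (hU : HasURank χ₀ ρ k) {r : α → Fin n} {c : β → Fin n} (hr : Function.Injective r)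
    (hc : Function.Injective c) (h : ∀ a b, r a ≠ c b) {S : Matrix β α F} {v : V} (hv : v ≠ 0)
    (hS : ∀ (T : Matrix α β F) (g : GL (Fin n) F),
      (g : Matrix (Fin n) (Fin n) F) = 1 + sel F r * T * (sel F c)ᵀ →
        ρ g v = χ₀ (S * T).trace • v) : S.rank ≤ k := by
  classical
  obtain ⟨a, ⟨eα⟩⟩ : ∃ a, Nonempty (Fin a ≃ α) := ⟨_, ⟨(Fintype.equivFin α).symm⟩⟩
  obtain ⟨b, ⟨eβ⟩⟩ : ∃ b, Nonempty (Fin b ≃ β) := ⟨_, ⟨(Fintype.equivFin β).symm⟩⟩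
  have hinj : Function.Injective (Sum.elim (r ∘ eα) (c ∘ eβ)) :=
    (hr.comp eα.injective).sumElim (hc.comp eβ.injective) fun x y => h _ _
  have hab : a + b ≤ n := by simpa using Fintype.card_le_of_injective _ hinj
  let B : StandardBlock n a b := ⟨0, a, by omega, hab⟩
  have hrow : Function.Injective B.rowIdx := fun x y hxy => by
    simpa [StandardBlock.rowIdx, Fin.ext_iff] using hxy
  have hcol : Function.Injective B.colIdx := fun x y hxy => by
    simpa [StandardBlock.colIdx, Fin.ext_iff] using hxy
  have hinj' : Function.Injective (Sum.elim B.rowIdx B.colIdx) :=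
    hrow.sumElim hcol fun x y => (B.colIdx_ne_rowIdx y x).symm
  obtain ⟨σ, hσ⟩ := exists_perm_extending hinj' hinj
  have hww : (sel F σ)ᵀ * sel F σ = 1 := sel_transpose_mul_sel_self σ.injective
  let w : GL (Fin n) F := ⟨sel F σ, (sel F σ)ᵀ, _root_.mul_eq_one_comm.1 hww, hww⟩
  have hSrank : (S.submatrix eβ eα).rank = S.rank := Matrix.rank_submatrix _ _ _
  rw [← hSrank]
  refine hU.2 ⟨a, b, B, S.submatrix eβ eα, ⟨ρ w⁻¹ v, fun h0 => hv ?_, fun T => ?_⟩, rfl⟩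
  · rw [← ρ.self_inv_apply w v, h0, map_zero]
  · have hwr : sel F σ * sel F B.rowIdx = sel F r * (sel F eα : Matrix α (Fin a) F) := by
      rw [sel_mul_sel, sel_mul_sel]
      exact congr_arg (sel F) (funext fun y => hσ (Sum.inl y))
    have hwc : sel F σ * sel F B.colIdx = sel F c * (sel F eβ : Matrix β (Fin b) F) := by
      rw [sel_mul_sel, sel_mul_sel]
      exact congr_arg (sel F) (funext fun y => hσ (Sum.inr y))
    let T' : Matrix α β F := sel F eα * T * (sel F eβ)ᵀ
    have h1 : (w * B.unipotent (Multiplicative.ofAdd T) * w⁻¹ : GL (Fin n) F) =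
        (1 + sel F r * T' * (sel F c)ᵀ : Matrix (Fin n) (Fin n) F) := by
      change sel F σ * (1 + B.place T) * (sel F σ)ᵀ = _
      have h2 : sel F r * T' * (sel F c)ᵀ =
          (sel F σ * sel F B.rowIdx) * T * (sel F σ * sel F B.colIdx)ᵀ := by
        rw [hwr, hwc, Matrix.transpose_mul]
        simp only [T', Matrix.mul_assoc]
      rw [h2, B.place_eq, Matrix.mul_add, Matrix.add_mul, Matrix.mul_one, Matrix.transpose_mul,
        _root_.mul_eq_one_comm.1 hww]
      simp only [Matrix.mul_assoc]
    have h2 := hS T' _ h1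
    have h3 : ρ (B.unipotent (Multiplicative.ofAdd T)) (ρ w⁻¹ v) =
        ρ w⁻¹ (ρ (w * B.unipotent (Multiplicative.ofAdd T) * w⁻¹) v) := by
      simp only [← Module.End.mul_apply, ← map_mul]
      congr 2
      group
    rw [h3, h2, map_smul]
    congr 1
    change _ = χ₀ (Matrix.trace (S.submatrix eβ eα * T))
    congr 1
    have h4 : S.submatrix eβ eα = (sel F eβ : Matrix β (Fin b) F)ᵀ * S * sel F eα := by
      ext x y
      simp [sel, Matrix.mul_apply, Matrix.one_apply]
    rw [h4, ← Matrix.mul_assoc, ← Matrix.mul_assoc, Matrix.trace_mul_comm]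
    simp only [Matrix.mul_assoc]

end RankBound

/-! ### Extending characters to a matrix subgroup -/

section Extension

variable {F : Type*} [Field F] [Finite F] {n : ℕ} {α β : Type*} [Fintype α] [Fintype β]
  {V : Type*} [AddCommGroup V] [Module ℂ V]

/-- A character of a part `H` of a matrix subgroup that appears in `ρ` extends to a character of the
whole matrix subgroup that appears in `ρ`. -/
theorem exists_eigenvector_extension {χ₀ : AddChar F ℂ} (hχ₀ : χ₀ ≠ 1)
    (ρ : Representation ℂ (GL (Fin n) F) V) {r : α → Fin n} {c : β → Fin n}
    (h : ∀ a b, r a ≠ c b) (H : Set (Matrix α β F)) (φ : Matrix α β F → ℂ) {v : V} (hv : v ≠ 0)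
    (hφ : ∀ T ∈ H, ∀ g : GL (Fin n) F,
      (g : Matrix (Fin n) (Fin n) F) = 1 + sel F r * T * (sel F c)ᵀ → ρ g v = φ T • v) :
    ∃ S : Matrix β α F, (∀ T ∈ H, χ₀ (S * T).trace = φ T) ∧ ∃ w : V, w ≠ 0 ∧
      ∀ (T : Matrix α β F) (g : GL (Fin n) F),
        (g : Matrix (Fin n) (Fin n) F) = 1 + sel F r * T * (sel F c)ᵀ →
          ρ g w = χ₀ (S * T).trace • w := by
  let u : Matrix α β F → GL (Fin n) F := fun T =>
    oneAdd (sel F r * T * (sel F c)ᵀ) (sel_mul_transpose_mul_self h T T)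
  have hu : ∀ T T', u (T + T') = u T * u T' := fun T T' => by
    ext1
    have := sel_mul_transpose_mul_self (F := F) h T T'
    simp only [u, coe_oneAdd, Units.val_mul, add_mul, mul_add, one_mul, mul_one, this,
      Matrix.mul_add, Matrix.add_mul]
    abel
  have hu0 : u 0 = 1 := by
    ext1
    simp [u]
  have hug : ∀ T (g : GL (Fin n) F),
      (g : Matrix (Fin n) (Fin n) F) = 1 + sel F r * T * (sel F c)ᵀ → g = u T := fun T g hg => by
    ext1
    rw [hg]
    rfl
  let W : Submodule ℂ V := ⨅ T ∈ H, LinearMap.ker (ρ (u T) - φ T • LinearMap.id)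
  have hW : ∀ w, w ∈ W ↔ ∀ T ∈ H, ρ (u T) w = φ T • w := fun w => by
    simp [W, Submodule.mem_iInf, sub_eq_zero]
  obtain ⟨ψ, w, hwW, hw0, hw⟩ := exists_character_eigenvector (fun T => ρ (u T))
    (by rw [hu0, map_one]; rfl) (fun T T' => by rw [hu, map_mul]; rfl) W
    (fun T w hw => (hW _).2 fun T' hT' => by
      have := (hW _).1 hw T' hT'
      rw [← map_smul, ← this, ← Module.End.mul_apply, ← Module.End.mul_apply, ← map_mul,
        ← map_mul, ← hu, ← hu, add_comm]) ((hW v).2 fun T hT => hφ T hT _ rfl) hv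
  obtain ⟨S, hS⟩ := exists_eq_addChar_trace hχ₀ ψ
  refine ⟨S, fun T hT => ?_, w, hw0, fun T g hg => ?_⟩
  · have h1 := (hW _).1 hwW T hT
    rw [hw, hS] at h1
    exact smul_left_injective ℂ hw0 h1
  · rw [hug T g hg, hw, hS]

/-- A character of a part `H` of a matrix subgroup that appears in `ρ` extends to a character of the
matrix subgroup of rank at most the `U`-rank. -/
theorem HasURank.exists_rank_le {χ₀ : AddChar F ℂ} (hχ₀ : χ₀ ≠ 1)
    {ρ : Representation ℂ (GL (Fin n) F) V} {k : ℕ}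
    (hU : HasURank χ₀ ρ k) {r : α → Fin n} {c : β → Fin n} (hr : Function.Injective r)
    (hc : Function.Injective c) (h : ∀ a b, r a ≠ c b) (H : Set (Matrix α β F))
    (φ : Matrix α β F → ℂ) {v : V} (hv : v ≠ 0)
    (hφ : ∀ T ∈ H, ∀ g : GL (Fin n) F,
      (g : Matrix (Fin n) (Fin n) F) = 1 + sel F r * T * (sel F c)ᵀ → ρ g v = φ T • v) :
    ∃ S : Matrix β α F, S.rank ≤ k ∧ ∀ T ∈ H, χ₀ (S * T).trace = φ T := by
  obtain ⟨S, hS, w, hw, hSw⟩ := exists_eigenvector_extension hχ₀ ρ h H φ hv hφ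
  exact ⟨S, hU.rank_le hr hc h hw hSw, hS⟩

end Extension

/-! ### Invertible minors -/

section Minor

theorem exists_linearIndependent_rows {F : Type*} [Field F] {α β : Type*} [Fintype α] [Fintype β]
    (S : Matrix β α F) {k : ℕ} (hk : S.rank = k) :
    ∃ c : Fin k → β, LinearIndependent F fun i => S (c i) := by
  have h := S.rank_eq_finrank_span_row
  rw [hk] at h
  subst h
  obtain ⟨f, hf, -, hli⟩ := Submodule.exists_fun_fin_finrank_span_eq F (Set.range S.row)
  choose c hc using hf
  refine ⟨c, ?_⟩
  have : (fun i => S (c i)) = f := funext hc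
  rwa [this]

theorem exists_submatrix_det_ne_zero {F : Type*} [Field F] {α β : Type*} [Fintype α] [Fintype β]
    (S : Matrix β α F) {k : ℕ} (hk : S.rank = k) :
    ∃ (c : Fin k → β) (r : Fin k → α), Function.Injective c ∧
      Function.Injective r ∧ (S.submatrix c r).det ≠ 0 := by
  obtain ⟨c, hc⟩ := exists_linearIndependent_rows S hk
  have hrank : (S.submatrix c id)ᵀ.rank = k := by
    rw [Matrix.rank_transpose]
    exact (LinearIndependent.rank_matrix (M := S.submatrix c id) hc).trans (by simp)
  obtain ⟨r, hr⟩ := exists_linearIndependent_rows _ hrank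
  refine ⟨c, r, hc.injective.of_comp, hr.injective.of_comp, ?_⟩
  have h1 : IsUnit (S.submatrix c r)ᵀ := Matrix.linearIndependent_rows_iff_isUnit.1 hr
  rw [← Matrix.det_transpose]
  exact ((Matrix.isUnit_iff_isUnit_det _).1 h1).ne_zero

end Minor

/-! ### Generation of `SL` by transvections -/

section SpecialLinear

/-- The special linear group is generated by transvections, in every size. The diagonal matrices
`diag (c, c⁻¹)` of `Matrix.SpecialLinearGroup.diagonal_transvection_induction'` are products of six
transvections. -/
theorem specialLinear_transvection_induction {F : Type*} [Field F] {μ : Type*} [Fintype μ]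
    [DecidableEq μ]
    (P : Matrix.SpecialLinearGroup μ F → Prop) (h1 : P 1)
    (htransvec : ∀ (i j : μ) (hij : i ≠ j) (t : F),
      P (Matrix.SpecialLinearGroup.transvection hij t))
    (hmul : ∀ A B, P A → P B → P (A * B)) (g : Matrix.SpecialLinearGroup μ F) : P g := by
  rcases subsingleton_or_nontrivial μ with h | h
  · have : Subsingleton (Matrix.SpecialLinearGroup μ F) := inferInstance
    rwa [Subsingleton.elim g 1]
  · refine Matrix.SpecialLinearGroup.diagonal_transvection_induction' P g
      (fun i j hij c hc => ?_) htransvec hmul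
    have : Matrix.SpecialLinearGroup.diag2n hij c hc =
        Matrix.SpecialLinearGroup.transvection hij c *
        Matrix.SpecialLinearGroup.transvection hij.symm (-c⁻¹) *
        Matrix.SpecialLinearGroup.transvection hij c *
        (Matrix.SpecialLinearGroup.transvection hij (-1) *
        Matrix.SpecialLinearGroup.transvection hij.symm 1 *
        Matrix.SpecialLinearGroup.transvection hij (-1)) := by
      have hd : Matrix.diagonal (fun k ↦ if k = i then c else if k = j then c⁻¹ else 1) =
          (1 : Matrix μ μ F) + Matrix.single i i (c - 1) + Matrix.single j j (c⁻¹ - 1) := by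
        ext a b
        simp only [Matrix.diagonal_apply, Matrix.add_apply, Matrix.one_apply, Matrix.single_apply]
        grind
      apply Subtype.ext
      rw [Matrix.SpecialLinearGroup.diag2n_coe, hd]
      simp only [Matrix.SpecialLinearGroup.coe_mul, Matrix.SpecialLinearGroup.transvection_coe,
        mul_add, add_mul, mul_one, one_mul, Matrix.single_mul_single_same, hij, hij.symm, ne_eq,
        not_false_eq_true, Matrix.single_mul_single_of_ne, mul_neg, neg_mul, mul_zero,
        add_zero, zero_add, mul_inv_cancel₀ hc, inv_mul_cancel₀ hc, sub_eq_add_neg,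
        Matrix.single_add, ← Matrix.single_neg]
      abel
    rw [this]
    exact hmul _ _ (hmul _ _ (hmul _ _ (htransvec _ _ _ _) (htransvec _ _ _ _))
      (htransvec _ _ _ _)) (hmul _ _ (hmul _ _ (htransvec _ _ _ _) (htransvec _ _ _ _))
      (htransvec _ _ _ _))

end SpecialLinear

/-! ### Three blocks of coordinates -/

section Blocks

variable {F : Type*} [Field F] {n : ℕ} {κ μ : Type*} (e : (κ ⊕ κ) ⊕ μ ≃ Fin n)

/-- The inclusion of the first block of coordinates. -/
def col₁ (F : Type*) [Field F] : Matrix (Fin n) κ F := sel F fun a => e (.inl (.inl a))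

/-- The inclusion of the second block of coordinates. -/
def col₂ (F : Type*) [Field F] : Matrix (Fin n) κ F := sel F fun a => e (.inl (.inr a))

/-- The inclusion of the third block of coordinates. -/
def col₃ (F : Type*) [Field F] : Matrix (Fin n) μ F := sel F fun a => e (.inr a)

theorem col₂_col₂ [DecidableEq κ] : (col₂ e F)ᵀ * col₂ e F = 1 :=
  sel_transpose_mul_sel_self fun _ _ h => by simpa using h

theorem col₃_col₃ [DecidableEq μ] : (col₃ e F)ᵀ * col₃ e F = 1 :=
  sel_transpose_mul_sel_self fun _ _ h => by simpa using h

theorem col₂_col₁ : (col₂ e F)ᵀ * col₁ e F = 0 := sel_transpose_mul_sel_of_ne (by simp)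

theorem col₂_col₃ : (col₂ e F)ᵀ * col₃ e F = 0 := sel_transpose_mul_sel_of_ne (by simp)

theorem col₃_col₁ : (col₃ e F)ᵀ * col₁ e F = 0 := sel_transpose_mul_sel_of_ne (by simp)

theorem col₃_col₂ : (col₃ e F)ᵀ * col₂ e F = 0 := sel_transpose_mul_sel_of_ne (by simp)

theorem col_sum [Fintype κ] [Fintype μ] :
    col₁ e F * (col₁ e F)ᵀ + col₂ e F * (col₂ e F)ᵀ + col₃ e F * (col₃ e F)ᵀ = 1 := by
  classical
  ext i j
  obtain ⟨i, rfl⟩ := e.surjective i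
  obtain ⟨j, rfl⟩ := e.surjective j
  rcases i with (i | i) | i <;> rcases j with (j | j) | j <;>
    simp [col₁, col₂, col₃, sel, Matrix.mul_apply, Matrix.one_apply]

theorem mul_assoc_of_mul_eq {a b c d : Type*} [Fintype b] [Fintype c] {A : Matrix a b F}
    {B : Matrix b c F} {C : Matrix a c F} (h : A * B = C) (X : Matrix c d F) :
    A * (B * X) = C * X := by
  rw [← Matrix.mul_assoc, h]

variable [Fintype μ]

/-- The general linear group of the third block of coordinates. -/
def blockGL [DecidableEq μ] : GL μ F →* GL (Fin n) F where
  toFun g :=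
    { val := 1 + col₃ e F * ((g : Matrix μ μ F) - 1) * (col₃ e F)ᵀ
      inv := 1 + col₃ e F * (((g⁻¹ : GL μ F) : Matrix μ μ F) - 1) * (col₃ e F)ᵀ
      val_inv := by
        have h : ((g : Matrix μ μ F)) * ((g⁻¹ : GL μ F) : Matrix μ μ F) = 1 := by simp
        simp only [mul_add, add_mul, mul_one, one_mul, Matrix.mul_assoc,
          mul_assoc_of_mul_eq (col₃_col₃ e), Matrix.one_mul, mul_sub, sub_mul,
          mul_assoc_of_mul_eq h, Matrix.mul_sub, Matrix.sub_mul]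
        abel
      inv_val := by
        have h : ((g⁻¹ : GL μ F) : Matrix μ μ F) * (g : Matrix μ μ F) = 1 := by simp
        simp only [mul_add, add_mul, mul_one, one_mul, Matrix.mul_assoc,
          mul_assoc_of_mul_eq (col₃_col₃ e), Matrix.one_mul, mul_sub, sub_mul,
          mul_assoc_of_mul_eq h, Matrix.mul_sub, Matrix.sub_mul]
        abel }
  map_one' := by ext1; simp
  map_mul' g h := by
    ext1
    simp only [Units.val_mul, mul_add, add_mul, mul_one, one_mul, Matrix.mul_assoc,
      mul_assoc_of_mul_eq (col₃_col₃ e), Matrix.one_mul, mul_sub, sub_mul, Matrix.mul_sub,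
      Matrix.sub_mul]
    abel

theorem coe_blockGL [DecidableEq μ] (g : GL μ F) : (blockGL e g : Matrix (Fin n) (Fin n) F) =
    1 + col₃ e F * ((g : Matrix μ μ F) - 1) * (col₃ e F)ᵀ := rfl

theorem det_blockGL [DecidableEq μ] (g : GL μ F) :
    (blockGL e g : Matrix (Fin n) (Fin n) F).det = (g : Matrix μ μ F).det := by
  rw [coe_blockGL, Matrix.mul_assoc, Matrix.det_one_add_mul_comm, Matrix.mul_assoc, col₃_col₃]
  simp

theorem sel_sumElim {α β ν : Type*} [DecidableEq ν] (r : α → ν) (c : β → ν) :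
    sel F (Sum.elim r c) = Matrix.fromCols (sel F r) (sel F c) := by
  ext i (j | j) <;> rfl

variable [Fintype κ] {V : Type*} [AddCommGroup V] [Module ℂ V]

/-- The vectors on which the unipotent radical with rows in the first block acts by the character
`T ↦ χ₀ (tr (S T))` of the second block, trivially extended to the third block. -/
def charSpace (χ₀ : AddChar F ℂ) (ρ : Representation ℂ (GL (Fin n) F) V) (S : Matrix κ κ F) :
    Submodule ℂ V where
  carrier := {v | ∀ (T : Matrix κ κ F) (T' : Matrix κ μ F) (g : GL (Fin n) F),
    (g : Matrix (Fin n) (Fin n) F) = 1 + col₁ e F * T * (col₂ e F)ᵀ + col₁ e F * T' * (col₃ e F)ᵀ →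
      ρ g v = χ₀ (S * T).trace • v}
  zero_mem' := by intro T T' g _; simp
  add_mem' hv hw := by
    intro T T' g hg
    rw [map_add, hv T T' g hg, hw T T' g hg, smul_add]
  smul_mem' c v hv := by
    intro T T' g hg
    rw [map_smul, hv T T' g hg, smul_comm]

/-- The character space is stable under the block upper triangular matrices `u` with identity
matrices in the first two diagonal blocks: conjugation by `u` does not change the component `T`. -/
theorem map_mem_charSpace {χ₀ : AddChar F ℂ} {ρ : Representation ℂ (GL (Fin n) F) V}
    {S : Matrix κ κ F} {u : GL (Fin n) F} {X : Matrix κ μ F} {Y : Matrix μ μ F}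
    (h₁ : (u : Matrix (Fin n) (Fin n) F) * col₁ e F = col₁ e F)
    (h₂ : (col₂ e F)ᵀ * (u : Matrix (Fin n) (Fin n) F) = (col₂ e F)ᵀ + X * (col₃ e F)ᵀ)
    (h₃ : (col₃ e F)ᵀ * (u : Matrix (Fin n) (Fin n) F) = Y * (col₃ e F)ᵀ)
    {v : V} (hv : v ∈ charSpace e χ₀ ρ S) : ρ u v ∈ charSpace e χ₀ ρ S := by
  intro T T' g hg
  have h₁' : ((u⁻¹ : GL (Fin n) F) : Matrix (Fin n) (Fin n) F) * col₁ e F = col₁ e F := by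
    nth_rw 1 [← h₁]
    rw [← Matrix.mul_assoc, Units.inv_mul, Matrix.one_mul]
  have h : ((u⁻¹ * g * u : GL (Fin n) F) : Matrix (Fin n) (Fin n) F) =
      1 + col₁ e F * T * (col₂ e F)ᵀ + col₁ e F * (T * X + T' * Y) * (col₃ e F)ᵀ := by
    have hu : ((u⁻¹ : GL (Fin n) F) : Matrix (Fin n) (Fin n) F) * u = 1 := Units.inv_mul u
    simp only [Units.val_mul, hg, mul_add, add_mul, mul_one, Matrix.mul_assoc, h₂, h₃, hu,
      mul_assoc_of_mul_eq h₁', Matrix.mul_add, Matrix.add_mul]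
    abel
  have h3 : ρ g (ρ u v) = ρ u (ρ (u⁻¹ * g * u) v) := by
    simp only [← Module.End.mul_apply, ← map_mul]
    congr 2
    group
  rw [h3, hv _ _ _ h, map_smul]

theorem blockGL_map_mem [DecidableEq μ] {χ₀ : AddChar F ℂ} {ρ : Representation ℂ (GL (Fin n) F) V}
    {S : Matrix κ κ F} (g : GL μ F) {v : V} (hv : v ∈ charSpace e χ₀ ρ S) :
    ρ (blockGL e g) v ∈ charSpace e χ₀ ρ S := by
  refine map_mem_charSpace e (X := 0) (Y := g) ?_ ?_ ?_ hv
  · simp [coe_blockGL, Matrix.mul_assoc, col₃_col₁, Matrix.add_mul]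
  · simp [coe_blockGL, Matrix.mul_assoc, mul_assoc_of_mul_eq (col₂_col₃ e), Matrix.mul_add]
  · simp [coe_blockGL, Matrix.mul_assoc, mul_assoc_of_mul_eq (col₃_col₃ e), Matrix.mul_add,
      Matrix.sub_mul]

/-- A character of rank `|κ|` of the matrix subgroup with rows in the first block and columns in the
second one extends by zero to the third block, up to conjugation. -/
theorem exists_mem_charSpace_ne_zero [DecidableEq κ] [DecidableEq μ] [Finite F]
    {χ₀ : AddChar F ℂ} (hχ₀ : χ₀ ≠ 1)
    {ρ : Representation ℂ (GL (Fin n) F) V} {S : Matrix κ κ F} (hS : S.det ≠ 0) {v : V}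
    (hv0 : v ≠ 0) (hv : ∀ (T : Matrix κ κ F) (g : GL (Fin n) F),
      (g : Matrix (Fin n) (Fin n) F) = 1 + col₁ e F * T * (col₂ e F)ᵀ →
        ρ g v = χ₀ (S * T).trace • v) :
    ∃ w ∈ charSpace e χ₀ ρ S, w ≠ 0 := by
  let c : κ ⊕ μ → Fin n := Sum.elim (fun a => e (.inl (.inr a))) fun a => e (.inr a)
  have hc : sel F c = Matrix.fromCols (col₂ e F) (col₃ e F) := sel_sumElim _ _
  have hplace : ∀ T : Matrix κ (κ ⊕ μ) F, sel F (fun a => e (.inl (.inl a))) * T * (sel F c)ᵀ =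
      col₁ e F * T.toCols₁ * (col₂ e F)ᵀ + col₁ e F * T.toCols₂ * (col₃ e F)ᵀ := fun T => by
    rw [hc, Matrix.transpose_fromCols]
    nth_rw 1 [← Matrix.fromCols_toCols T]
    rw [Matrix.mul_fromCols, Matrix.fromCols_mul_fromRows]
    rfl
  obtain ⟨S', hS', w, hw0, hw⟩ := exists_eigenvector_extension hχ₀ ρ
    (r := fun a => e (.inl (.inl a))) (c := c) (by rintro a (b | b) <;> simp [c])
    {T : Matrix κ (κ ⊕ μ) F | T.toCols₂ = 0} (fun T => χ₀ (S * T.toCols₁).trace) hv0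
    fun T (hT : T.toCols₂ = 0) g hg => hv _ _ (by
      rw [hg, hplace, hT, Matrix.mul_zero, Matrix.zero_mul, add_zero])
  have htr : ∀ T : Matrix κ (κ ⊕ μ) F, (S' * T).trace =
      (S'.toRows₁ * T.toCols₁).trace + (S'.toRows₂ * T.toCols₂).trace := fun T => by
    simp [Matrix.trace, Matrix.mul_apply, Fintype.sum_sum_type]
  have hS₁ : S'.toRows₁ = S := by
    rw [← sub_eq_zero]
    refine eq_zero_of_addChar_trace_eq_one hχ₀ fun T => ?_
    have h1 := hS' (Matrix.fromCols T 0) (by simp)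
    rw [htr] at h1
    simp only [Matrix.toCols₁_fromCols, Matrix.toCols₂_fromCols, Matrix.mul_zero, Matrix.trace_zero,
      add_zero] at h1
    rw [Matrix.sub_mul, Matrix.trace_sub, sub_eq_add_neg, AddChar.map_add_eq_mul, h1,
      ← AddChar.map_add_eq_mul, add_neg_cancel, AddChar.map_zero_eq_one]
  have hZ : (col₃ e F * (-(S'.toRows₂ * S⁻¹)) * (col₂ e F)ᵀ) *
      (col₃ e F * (-(S'.toRows₂ * S⁻¹)) * (col₂ e F)ᵀ) = 0 := by
    simp [Matrix.mul_assoc, mul_assoc_of_mul_eq (col₂_col₃ e)]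
  -- Conjugation by `u` removes the component of the character on the third block.
  let u := oneAdd _ hZ
  refine ⟨ρ u w, fun T T' g hg => ?_, fun h0 => hw0 ?_⟩
  · have h : ((u⁻¹ * g * u : GL (Fin n) F) : Matrix (Fin n) (Fin n) F) =
        1 + sel F (fun a => e (.inl (.inl a))) *
          Matrix.fromCols (T + T' * (-(S'.toRows₂ * S⁻¹))) T' * (sel F c)ᵀ := by
      rw [hplace]
      have hZ' := hZ
      simp only [Matrix.mul_assoc] at hZ'
      simp only [u, Units.val_mul, coe_inv_oneAdd, coe_oneAdd, hg, mul_add,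
        add_mul, sub_mul, mul_one, one_mul, Matrix.mul_assoc, Matrix.mul_add,
        Matrix.add_mul, Matrix.toCols₁_fromCols, Matrix.toCols₂_fromCols,
        mul_assoc_of_mul_eq (col₂_col₃ e), mul_assoc_of_mul_eq (col₂_col₁ e),
        mul_assoc_of_mul_eq (col₃_col₃ e), Matrix.zero_mul, Matrix.mul_zero, Matrix.one_mul]
      abel
    have h3 : ρ g (ρ u w) = ρ u (ρ (u⁻¹ * g * u) w) := by
      simp only [← Module.End.mul_apply, ← map_mul]
      congr 2
      group
    rw [h3, hw _ _ h, map_smul, htr, hS₁, Matrix.toCols₁_fromCols, Matrix.toCols₂_fromCols,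
      Matrix.mul_add, Matrix.trace_add, ← Matrix.mul_assoc S, Matrix.trace_mul_comm (S * T'),
      Matrix.neg_mul, Matrix.trace_neg, Matrix.mul_assoc, ← Matrix.mul_assoc S⁻¹,
      Matrix.nonsing_inv_mul _ (isUnit_iff_ne_zero.2 hS), Matrix.one_mul, neg_add_cancel_right]
  · rw [← ρ.inv_self_apply u w, h0, map_zero]

/-- Transvections of the third block fix the character space: otherwise a character of rank
`|κ| + 1` would appear in `ρ`, namely on the matrix subgroup with rows in the first block and at
`i`, and columns in the second block and at `j`. -/
theorem transvection_apply_of_mem_charSpace [DecidableEq κ] [DecidableEq μ] [Finite F]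
    {χ₀ : AddChar F ℂ} (hχ₀ : χ₀ ≠ 1)
    {ρ : Representation ℂ (GL (Fin n) F) V} {S : Matrix κ κ F} (hS : S.det ≠ 0)
    (hU : HasURank χ₀ ρ (Fintype.card κ)) {v : V} (hv : v ∈ charSpace e χ₀ ρ S) {i j : μ}
    (hij : i ≠ j) (t : F) {g : GL μ F} (hg : (g : Matrix μ μ F) = 1 + Matrix.single i j t) :
    ρ (blockGL e g) v = v := by
  by_contra hne
  let p : μ → Matrix μ Unit F := fun i => sel F fun _ => i
  have hpi : (p j)ᵀ * p i = 0 := sel_transpose_mul_sel_of_ne fun _ _ => hij.symm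
  have hsq : ∀ x y : Matrix Unit Unit F, (col₃ e F * (p i * x * (p j)ᵀ) * (col₃ e F)ᵀ) *
      (col₃ e F * (p i * y * (p j)ᵀ) * (col₃ e F)ᵀ) = 0 := fun x y => by
    simp [Matrix.mul_assoc, mul_assoc_of_mul_eq (col₃_col₃ e), mul_assoc_of_mul_eq hpi]
  let u : Matrix Unit Unit F → GL (Fin n) F := fun x => oneAdd _ (hsq x x)
  have hu0 : u 0 = 1 := by
    ext1
    simp [u]
  have hu : ∀ x y, u (x + y) = u x * u y := fun x y => by
    ext1
    simp only [u, Units.val_mul, coe_oneAdd, mul_add, add_mul, mul_one, one_mul, hsq,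
      Matrix.mul_add, Matrix.add_mul]
    abel
  have hut : u (Matrix.single () () t) = blockGL e g := by
    ext1
    simp only [u, p, coe_oneAdd, coe_blockGL, hg, add_sub_cancel_left,
      sel_mul_single_mul_sel_transpose]
  -- A nontrivial character `s` of the root subgroup at `(i, j)` appears in the character space.
  obtain ⟨ψ, hψ, w, hw, hw0, hwψ⟩ := exists_nontrivial_character_eigenvector (fun x => ρ (u x))
    (by rw [hu0, map_one]; rfl) (fun x y => by rw [hu, map_mul]; rfl) (charSpace e χ₀ ρ S)
    (fun x w hw => by
      refine map_mem_charSpace e (X := 0) (Y := 1 + p i * x * (p j)ᵀ) ?_ ?_ ?_ hw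
      · simp [u, Matrix.mul_assoc, col₃_col₁, Matrix.add_mul]
      · simp [u, Matrix.mul_assoc, mul_assoc_of_mul_eq (col₂_col₃ e), Matrix.mul_add]
      · simp [u, Matrix.mul_assoc, mul_assoc_of_mul_eq (col₃_col₃ e), Matrix.mul_add,
          Matrix.add_mul]) hv (a := Matrix.single () () t) (by rw [hut]; exact hne)
  obtain ⟨s, hs⟩ := exists_eq_addChar_trace hχ₀ ψ
  have hs0 : s ≠ 0 := by
    rintro rfl
    exact hψ (DFunLike.ext _ _ fun x => by simp [hs])
  -- Together with the second block, it gives a character of rank `|κ| + 1`.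
  let r : κ ⊕ Unit → Fin n := Sum.elim (fun a => e (.inl (.inl a))) fun _ => e (.inr i)
  let c : κ ⊕ Unit → Fin n := Sum.elim (fun a => e (.inl (.inr a))) fun _ => e (.inr j)
  have hr : sel F r = Matrix.fromCols (col₁ e F) (col₃ e F * p i) := by
    rw [sel_sumElim, col₃, sel_mul_sel]
    rfl
  have hc : sel F c = Matrix.fromCols (col₂ e F) (col₃ e F * p j) := by
    rw [sel_sumElim, col₃, sel_mul_sel]
    rfl
  obtain ⟨S', hrank, hS'⟩ := hU.exists_rank_le hχ₀ (r := r) (c := c)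
    (by rintro (a | a) (b | b) <;> simp [r]) (by rintro (a | a) (b | b) <;> simp [c])
    (by rintro (a | a) (b | b) <;> simp [r, c, hij])
    {T : Matrix (κ ⊕ Unit) (κ ⊕ Unit) F | T.toBlocks₂₁ = 0}
    (fun T => χ₀ (S * T.toBlocks₁₁).trace * χ₀ (s * T.toBlocks₂₂).trace) hw0
    fun T (hT : T.toBlocks₂₁ = 0) g' hg' => by
      have hg'' : (g' : Matrix (Fin n) (Fin n) F) = 1 + col₁ e F * T.toBlocks₁₁ * (col₂ e F)ᵀ +
          col₁ e F * T.toBlocks₁₂ * (col₃ e F * p j)ᵀ +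
          col₃ e F * (p i * T.toBlocks₂₂ * (p j)ᵀ) * (col₃ e F)ᵀ := by
        nth_rw 1 [hg', hr, hc, ← Matrix.fromBlocks_toBlocks T]
        rw [Matrix.fromCols_mul_fromBlocks, Matrix.transpose_fromCols,
          Matrix.fromCols_mul_fromRows, hT]
        simp only [Matrix.transpose_mul, Matrix.mul_assoc, Matrix.mul_zero, add_zero,
          Matrix.add_mul]
        abel
      have h12 : ((g' * (u T.toBlocks₂₂)⁻¹ : GL (Fin n) F) : Matrix (Fin n) (Fin n) F) =
          1 + col₁ e F * T.toBlocks₁₁ * (col₂ e F)ᵀ +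
            col₁ e F * (T.toBlocks₁₂ * (p j)ᵀ) * (col₃ e F)ᵀ := by
        simp only [u, Units.val_mul, coe_inv_oneAdd, hg'', add_mul, mul_sub, mul_one, one_mul,
          Matrix.mul_assoc, Matrix.transpose_mul, mul_assoc_of_mul_eq (col₂_col₃ e),
          mul_assoc_of_mul_eq (col₃_col₃ e), mul_assoc_of_mul_eq hpi, Matrix.zero_mul,
          Matrix.mul_zero, Matrix.one_mul]
        abel
      have h3 : ρ g' w = ρ (g' * (u T.toBlocks₂₂)⁻¹) (ρ (u T.toBlocks₂₂) w) := by
        rw [← Module.End.mul_apply, ← map_mul, inv_mul_cancel_right]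
      rw [h3, hwψ, map_smul, hw _ _ _ h12, smul_smul, hs, mul_comm]
  have htr : ∀ T : Matrix (κ ⊕ Unit) (κ ⊕ Unit) F, T.toBlocks₂₁ = 0 → (S' * T).trace =
      (S'.toBlocks₁₁ * T.toBlocks₁₁).trace + (S'.toBlocks₂₁ * T.toBlocks₁₂).trace +
        (S'.toBlocks₂₂ * T.toBlocks₂₂).trace := fun T hT => by
    have h0 : ∀ a, T (Sum.inr ()) (Sum.inl a) = 0 := fun a => congr_fun (congr_fun hT ()) a
    simp [Matrix.trace, Matrix.mul_apply, Fintype.sum_sum_type, Matrix.toBlocks₁₁,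
      Matrix.toBlocks₁₂, Matrix.toBlocks₂₁, Matrix.toBlocks₂₂, h0, add_assoc]
  have hS₁ : S'.toBlocks₁₁ = S := by
    rw [← sub_eq_zero]
    refine eq_zero_of_addChar_trace_eq_one hχ₀ fun T => ?_
    have h1 := hS' (Matrix.fromBlocks T 0 0 0) (by simp)
    rw [htr _ (by simp)] at h1
    simp only [Matrix.toBlocks_fromBlocks₁₁, Matrix.toBlocks_fromBlocks₁₂,
      Matrix.toBlocks_fromBlocks₂₂, Matrix.mul_zero, Matrix.trace_zero, add_zero,
      AddChar.map_zero_eq_one, mul_one] at h1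
    rw [Matrix.sub_mul, Matrix.trace_sub, sub_eq_add_neg, AddChar.map_add_eq_mul, h1,
      ← AddChar.map_add_eq_mul, add_neg_cancel, AddChar.map_zero_eq_one]
  have hS₂ : S'.toBlocks₂₁ = 0 := by
    refine eq_zero_of_addChar_trace_eq_one hχ₀ fun T => ?_
    have h1 := hS' (Matrix.fromBlocks 0 T 0 0) (by simp)
    rw [htr _ (by simp)] at h1
    simpa only [Matrix.toBlocks_fromBlocks₁₁, Matrix.toBlocks_fromBlocks₁₂,
      Matrix.toBlocks_fromBlocks₂₂, Matrix.mul_zero, Matrix.trace_zero, add_zero, zero_add,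
      AddChar.map_zero_eq_one, mul_one] using h1
  have hS₃ : S'.toBlocks₂₂ = s := by
    rw [← sub_eq_zero]
    refine eq_zero_of_addChar_trace_eq_one hχ₀ fun T => ?_
    have h1 := hS' (Matrix.fromBlocks 0 0 0 T) (by simp)
    rw [htr _ (by simp)] at h1
    simp only [Matrix.toBlocks_fromBlocks₁₁, Matrix.toBlocks_fromBlocks₁₂,
      Matrix.toBlocks_fromBlocks₂₂, Matrix.mul_zero, Matrix.trace_zero, zero_add,
      AddChar.map_zero_eq_one, one_mul] at h1
    rw [Matrix.sub_mul, Matrix.trace_sub, sub_eq_add_neg, AddChar.map_add_eq_mul, h1,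
      ← AddChar.map_add_eq_mul, add_neg_cancel, AddChar.map_zero_eq_one]
  have hsdet : s.det ≠ 0 := by
    rw [Matrix.det_unique]
    exact fun h => hs0 (by ext; exact h)
  have hdet : S'.det ≠ 0 := by
    rw [← Matrix.fromBlocks_toBlocks S', hS₂, Matrix.det_fromBlocks_zero₂₁, hS₁, hS₃]
    exact mul_ne_zero hS hsdet
  rw [Matrix.rank_of_isUnit _ ((Matrix.isUnit_iff_isUnit_det _).2 (isUnit_iff_ne_zero.2 hdet)),
    Fintype.card_sum, Fintype.card_unit] at hrank
  omega

end Blocks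

/-! ### The stabilizer of the first two blocks -/

section CharSpaceAction

variable {F : Type*} [Field F] [Finite F] {n : ℕ} {κ μ : Type*} [Fintype κ] [DecidableEq κ]
  [Fintype μ] [DecidableEq μ] (e : (κ ⊕ κ) ⊕ μ ≃ Fin n) {V : Type*} [AddCommGroup V] [Module ℂ V]
  {χ₀ : AddChar F ℂ} {ρ : Representation ℂ (GL (Fin n) F) V} {S : Matrix κ κ F}

theorem blockGL_apply_of_det_eq_one (hχ₀ : χ₀ ≠ 1) (hS : S.det ≠ 0)
    (hU : HasURank χ₀ ρ (Fintype.card κ)) {v : V} (hv : v ∈ charSpace e χ₀ ρ S) {g : GL μ F}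
    (hg : (g : Matrix μ μ F).det = 1) : ρ (blockGL e g) v = v := by
  have key : ∀ A : Matrix.SpecialLinearGroup μ F, ∀ v ∈ charSpace e χ₀ ρ S,
      ρ (blockGL e A.toGL) v = v := by
    refine specialLinear_transvection_induction _ (fun v _ => by simp) (fun i j hij t v hv => ?_)
      fun A B hA hB v hv => by
        rw [map_mul, map_mul, map_mul, Module.End.mul_apply, hB v hv, hA v hv]
    exact transvection_apply_of_mem_charSpace e hχ₀ hS hU hv hij t rfl
  have : g = Matrix.SpecialLinearGroup.toGL ⟨g, hg⟩ := by
    ext1; rfl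
  rw [this]
  exact key _ v hv

/-- As the special linear group of the third block acts trivially on the character space, the
general linear group acts through the determinant, which has commutative image. -/
theorem exists_det_eigenvector [Nonempty μ] (hχ₀ : χ₀ ≠ 1) (hS : S.det ≠ 0)
    (hU : HasURank χ₀ ρ (Fintype.card κ)) {v : V} (hv : v ∈ charSpace e χ₀ ρ S) (hv0 : v ≠ 0) :
    ∃ χ : GL (Fin n) F →* ℂˣ,
      (∀ g h : GL (Fin n) F, (g : Matrix (Fin n) (Fin n) F).det =
        (h : Matrix (Fin n) (Fin n) F).det → χ g = χ h) ∧
      ∃ w ∈ charSpace e χ₀ ρ S, w ≠ 0 ∧ ∀ g : GL μ F,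
        ρ (blockGL e g) w = (χ (blockGL e g) : ℂ) • w := by
  obtain ⟨i₀⟩ := ‹Nonempty μ›
  let D : Fˣ →* GL μ F := (Units.map (Matrix.diagonalRingHom μ F).toMonoidHom).comp
    (Units.map (MonoidHom.mulSingle (fun _ : μ => F) i₀))
  have hD : ∀ t : Fˣ, (D t : Matrix μ μ F).det = t := fun t => by
    change (Matrix.diagonal (Pi.mulSingle i₀ (t : F))).det = _
    rw [Matrix.det_diagonal]
    simp [Pi.mulSingle_apply]
  obtain ⟨ψ, w, hw, hw0, hψ⟩ := exists_character_eigenvector (A := Additive Fˣ)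
    (fun t => ρ (blockGL e (D t.toMul))) (by rw [toMul_zero, map_one, map_one, map_one]; rfl)
    (fun s t => by rw [toMul_add, map_mul, map_mul, map_mul]; rfl) (charSpace e χ₀ ρ S)
    (fun t w hw => blockGL_map_mem e _ hw) hv hv0
  let θ : Fˣ →* ℂ :=
    { toFun := fun t => ψ (Additive.ofMul t)
      map_one' := ψ.map_zero_eq_one
      map_mul' := fun s t => ψ.map_add_eq_mul _ _ }
  refine ⟨θ.toHomUnits.comp Matrix.GeneralLinearGroup.det, fun g h hgh => ?_, w, hw, hw0,
    fun g => ?_⟩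
  · rw [MonoidHom.comp_apply, MonoidHom.comp_apply]
    congr 1
    exact Units.ext hgh
  · have hdet : Matrix.GeneralLinearGroup.det (blockGL e g) = Matrix.GeneralLinearGroup.det g :=
      Units.ext (det_blockGL e g)
    let t := Matrix.GeneralLinearGroup.det g
    have h1 : (((D t)⁻¹ * g : GL μ F) : Matrix μ μ F).det = 1 := by
      have h2 : Matrix.GeneralLinearGroup.det ((D t)⁻¹ * g) = 1 := by
        rw [map_mul, map_inv, show Matrix.GeneralLinearGroup.det (D t) = t from Units.ext (hD t),
          inv_mul_cancel]
      exact congr_arg Units.val h2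
    have h3 : ρ (blockGL e g) w = ρ (blockGL e (D t)) (ρ (blockGL e ((D t)⁻¹ * g)) w) := by
      rw [← Module.End.mul_apply, ← map_mul, ← map_mul, mul_inv_cancel_left]
    rw [h3, blockGL_apply_of_det_eq_one e hχ₀ hS hU hw h1]
    refine (hψ (Additive.ofMul t)).trans (congr_arg (· • w) ?_)
    change _ = θ (Matrix.GeneralLinearGroup.det (blockGL e g))
    rw [hdet]
    rfl

/-- The matrix subgroup with rows in the second and columns in the third block fixes the character
space, being generated by commutators with transvections of the third block. -/
theorem unipotent_apply_of_mem_charSpace (hμ : Nonempty κ → Nontrivial μ)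
    (hχ₀ : χ₀ ≠ 1) (hS : S.det ≠ 0)
    (hU : HasURank χ₀ ρ (Fintype.card κ)) {v : V} (hv : v ∈ charSpace e χ₀ ρ S)
    (X : Matrix κ μ F) {g : GL (Fin n) F}
    (hg : (g : Matrix (Fin n) (Fin n) F) = 1 + col₂ e F * X * (col₃ e F)ᵀ) : ρ g v = v := by
  have hsq : ∀ X Y : Matrix κ μ F, (col₂ e F * X * (col₃ e F)ᵀ) *
      (col₂ e F * Y * (col₃ e F)ᵀ) = 0 := fun X Y => by
    simp [Matrix.mul_assoc, mul_assoc_of_mul_eq (col₃_col₂ e)]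
  let u : Matrix κ μ F → GL (Fin n) F := fun X => oneAdd _ (hsq X X)
  have hu : ∀ X Y, u (X + Y) = u X * u Y := fun X Y => by
    ext1
    simp only [u, Units.val_mul, coe_oneAdd, mul_add, add_mul, mul_one, one_mul, hsq,
      Matrix.mul_add, Matrix.add_mul]
    abel
  have hmem : ∀ X, ∀ w ∈ charSpace e χ₀ ρ S, ρ (u X) w ∈ charSpace e χ₀ ρ S := fun X w hw => by
    refine map_mem_charSpace e (X := X) (Y := 1) ?_ ?_ ?_ hw
    · simp [u, Matrix.mul_assoc, col₃_col₁, Matrix.add_mul]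
    · simp [u, Matrix.mul_assoc, mul_assoc_of_mul_eq (col₂_col₂ e), Matrix.mul_add]
    · simp [u, Matrix.mul_assoc, mul_assoc_of_mul_eq (col₃_col₂ e), Matrix.mul_add]
  have hgu : g = u X := by
    ext1
    rw [hg]
    rfl
  rw [hgu]
  clear hg hgu
  induction X using Matrix.induction_on' with
  | h_zero =>
    have : u 0 = 1 := by
      ext1
      simp [u]
    rw [this, map_one]
    rfl
  | h_add X Y hX hY => rw [hu, map_mul, Module.End.mul_apply, hY, hX]
  | h_std_basis a b t =>
    -- `u (E_ab)` is a commutator of `u (E_ac)` and the transvection at `(c, b)`.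
    have := hμ ⟨a⟩
    obtain ⟨c, hc⟩ := exists_ne b
    let y : GL μ F := Matrix.SpecialLinearGroup.toGL (Matrix.SpecialLinearGroup.transvection hc 1)
    have hy : (y : Matrix μ μ F) = 1 + Matrix.single c b 1 := rfl
    have hcomm : u (Matrix.single a c t) * blockGL e y =
        blockGL e y * u (Matrix.single a b t) * u (Matrix.single a c t) := by
      have hs : (Matrix.single a c t : Matrix κ μ F) * (Matrix.single c b 1 : Matrix μ μ F) =
          Matrix.single a b t := by simp
      ext1
      simp only [u, Units.val_mul, coe_oneAdd, coe_blockGL, hy, add_sub_cancel_left, mul_add,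
        add_mul, mul_one, one_mul, Matrix.mul_assoc, mul_assoc_of_mul_eq (col₃_col₃ e),
        mul_assoc_of_mul_eq (col₃_col₂ e), Matrix.zero_mul, Matrix.mul_zero, Matrix.one_mul,
        mul_assoc_of_mul_eq hs]
      abel
    have hy1 : ∀ w ∈ charSpace e χ₀ ρ S, ρ (blockGL e y) w = w := fun w hw =>
      blockGL_apply_of_det_eq_one e hχ₀ hS hU hw (by
        rw [hy]; exact Matrix.det_transvection_of_ne c b hc 1)
    have hw : v = ρ (u (Matrix.single a c t)) (ρ (u (-Matrix.single a c t)) v) := by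
      have h0 : u 0 = 1 := by
        ext1
        simp [u]
      rw [← Module.End.mul_apply, ← map_mul, ← hu, add_neg_cancel, h0, map_one]
      rfl
    have h1 := LinearMap.congr_fun (congr_arg ρ hcomm) (ρ (u (-Matrix.single a c t)) v)
    rw [map_mul, map_mul, map_mul, Module.End.mul_apply, Module.End.mul_apply,
      Module.End.mul_apply, hy1 _ (hmem _ _ hv), ← hw, hy1 _ (hmem _ _ hv)] at h1
    exact h1.symm

/-- The pointwise stabilizer of the first two blocks of coordinates acts on some vector of the
character space by the restriction of a character of `GL_n`, so that Frobenius reciprocity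
applies. -/
theorem occursIn_of_mem_charSpace [ρ.IsIrreducible] [Nonempty μ] (hμ : Nonempty κ → Nontrivial μ)
    (hχ₀ : χ₀ ≠ 1) (hS : S.det ≠ 0) (hU : HasURank χ₀ ρ (Fintype.card κ)) {v : V}
    (hv : v ∈ charSpace e χ₀ ρ S) (hv0 : v ≠ 0) : OccursIn (κ ⊕ κ) ρ := by
  obtain ⟨χ, hχ, w, hw, hw0, hwχ⟩ := exists_det_eigenvector e hχ₀ hS hU hv hv0
  refine occursIn_of_stabilizer χ (Matrix.fromCols (col₁ e F) (col₂ e F)) hw0 fun g hg => ?_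
  rw [Matrix.mul_fromCols, Matrix.fromCols_inj.eq_iff] at hg
  obtain ⟨hg₁, hg₂⟩ := hg
  have hinv : ∀ {X : Matrix (Fin n) κ F}, (g : Matrix (Fin n) (Fin n) F) * X = X →
      ((g⁻¹ : GL (Fin n) F) : Matrix (Fin n) (Fin n) F) * X = X := fun {X} hX => by
    nth_rw 1 [← hX]
    rw [← Matrix.mul_assoc, Units.inv_mul, Matrix.one_mul]
  have h33 : ∀ {p q : Matrix (Fin n) (Fin n) F}, p * col₁ e F = col₁ e F → p * col₂ e F = col₂ e F →
      p * q = 1 → (col₃ e F)ᵀ * p * col₃ e F * ((col₃ e F)ᵀ * q * col₃ e F) = 1 :=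
    fun {p q} h₁ h₂ hpq => by
      have h3 : col₃ e F * (col₃ e F)ᵀ = 1 - col₁ e F * (col₁ e F)ᵀ - col₂ e F * (col₂ e F)ᵀ := by
        rw [← col_sum e]
        abel
      calc _ = (col₃ e F)ᵀ * p * (col₃ e F * (col₃ e F)ᵀ) * q * col₃ e F := by
            simp only [Matrix.mul_assoc]
        _ = 1 := by
            rw [h3]
            simp only [Matrix.mul_sub, Matrix.mul_one, Matrix.mul_assoc,
              mul_assoc_of_mul_eq h₁, mul_assoc_of_mul_eq h₂, mul_assoc_of_mul_eq hpq,
              mul_assoc_of_mul_eq (col₃_col₁ e), mul_assoc_of_mul_eq (col₃_col₂ e), col₃_col₃,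
              Matrix.zero_mul, Matrix.one_mul, sub_zero]
  let D : GL μ F :=
    ⟨(col₃ e F)ᵀ * (g : Matrix (Fin n) (Fin n) F) * col₃ e F,
      (col₃ e F)ᵀ * ((g⁻¹ : GL (Fin n) F) : Matrix (Fin n) (Fin n) F) * col₃ e F,
      h33 hg₁ hg₂ (Units.mul_inv g), h33 (hinv hg₁) (hinv hg₂) (Units.inv_mul g)⟩
  have hsq₁ : ∀ X : Matrix κ μ F, (col₁ e F * X * (col₃ e F)ᵀ) *
      (col₁ e F * X * (col₃ e F)ᵀ) = 0 := fun X => by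
    simp [Matrix.mul_assoc, mul_assoc_of_mul_eq (col₃_col₁ e)]
  have hsq₂ : ∀ X : Matrix κ μ F, (col₂ e F * X * (col₃ e F)ᵀ) *
      (col₂ e F * X * (col₃ e F)ᵀ) = 0 := fun X => by
    simp [Matrix.mul_assoc, mul_assoc_of_mul_eq (col₃_col₂ e)]
  -- `g` is block upper triangular, with identity matrices in the first two diagonal blocks
  let p := oneAdd _ (hsq₁ ((col₁ e F)ᵀ * (g : Matrix (Fin n) (Fin n) F) * col₃ e F))
  let q := oneAdd _ (hsq₂ ((col₂ e F)ᵀ * (g : Matrix (Fin n) (Fin n) F) * col₃ e F))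
  have hfac : g = blockGL e D * (p * q) := by
    have hcol : (g : Matrix (Fin n) (Fin n) F) * col₃ e F =
        col₁ e F * ((col₁ e F)ᵀ * (g : Matrix (Fin n) (Fin n) F) * col₃ e F) +
          col₂ e F * ((col₂ e F)ᵀ * (g : Matrix (Fin n) (Fin n) F) * col₃ e F) +
          col₃ e F * ((col₃ e F)ᵀ * (g : Matrix (Fin n) (Fin n) F) * col₃ e F) := by
      simp only [← Matrix.mul_assoc, ← Matrix.add_mul, col_sum, Matrix.one_mul]
    have hg3 : (g : Matrix (Fin n) (Fin n) F) = 1 - col₃ e F * (col₃ e F)ᵀ +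
        (g : Matrix (Fin n) (Fin n) F) * col₃ e F * (col₃ e F)ᵀ := by
      have h1 : (g : Matrix (Fin n) (Fin n) F) * (col₁ e F * (col₁ e F)ᵀ +
          col₂ e F * (col₂ e F)ᵀ + col₃ e F * (col₃ e F)ᵀ) = g := by
        rw [col_sum, mul_one]
      rw [← col_sum e, add_sub_cancel_right]
      nth_rw 1 [← h1]
      simp only [mul_add, ← Matrix.mul_assoc, hg₁, hg₂]
    ext1
    nth_rw 1 [hg3]
    rw [hcol]
    simp only [p, q, D, Units.val_mul, coe_oneAdd, coe_blockGL, mul_add, add_mul, mul_one, one_mul,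
      Matrix.mul_assoc, Matrix.mul_sub, Matrix.sub_mul, Matrix.add_mul,
      mul_assoc_of_mul_eq (col₃_col₁ e), mul_assoc_of_mul_eq (col₃_col₂ e), Matrix.zero_mul,
      Matrix.mul_zero, Matrix.one_mul]
    abel
  have hp : ρ p w = w := by
    rw [hw 0 ((col₁ e F)ᵀ * (g : Matrix (Fin n) (Fin n) F) * col₃ e F) p (by simp [p])]
    simp
  have hq : ρ q w = w := unipotent_apply_of_mem_charSpace e hμ hχ₀ hS hU hw _ rfl
  have hdet : (g : Matrix (Fin n) (Fin n) F).det =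
      (blockGL e D : Matrix (Fin n) (Fin n) F).det := by
    have hp' : (p : Matrix (Fin n) (Fin n) F).det = 1 := by
      rw [coe_oneAdd, Matrix.det_one_add_mul_comm, ← Matrix.mul_assoc, col₃_col₁]
      simp
    have hq' : (q : Matrix (Fin n) (Fin n) F).det = 1 := by
      rw [coe_oneAdd, Matrix.det_one_add_mul_comm, ← Matrix.mul_assoc, col₃_col₂]
      simp
    rw [hfac, Units.val_mul, Units.val_mul, Matrix.det_mul, Matrix.det_mul, hp', hq', mul_one,
      mul_one]
  rw [hχ g _ hdet, ← hwχ D]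
  nth_rw 1 [hfac]
  rw [map_mul, map_mul, Module.End.mul_apply, Module.End.mul_apply, hq, hp]

end CharSpaceAction

section LargeRank

variable {F : Type*} [Field F] [Finite F] {n k : ℕ} {V : Type*} [AddCommGroup V] [Module ℂ V]
  {χ₀ : AddChar F ℂ} {ρ : Representation ℂ (GL (Fin n) F) V}

/-- A representation of `U`-rank `k` occurs in the functions on `n × 2k` matrices. -/
theorem HasURank.occursIn [ρ.IsIrreducible] (hχ₀ : χ₀ ≠ 1) (hU : HasURank χ₀ ρ k)
    (hn : 0 < n) (hkn : 2 * k + 1 < n ∨ k = 0) : OccursIn (Fin k ⊕ Fin k) ρ := by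
  obtain ⟨a, b, B, S, ⟨v, hv0, hv⟩, hS⟩ := hU.1
  obtain ⟨c, r, hc, hr, hdet⟩ := exists_submatrix_det_ne_zero S hS
  have hf : Function.Injective (Sum.elim (B.rowIdx ∘ r) (B.colIdx ∘ c)) := by
    refine Function.Injective.sumElim (fun x y h => hr ?_) (fun x y h => hc ?_) fun x y =>
      (B.colIdx_ne_rowIdx _ _).symm
    · simpa [StandardBlock.rowIdx, Fin.ext_iff] using h
    · simpa [StandardBlock.colIdx, Fin.ext_iff] using h
  obtain ⟨m, hm⟩ : ∃ m, n = k + k + m := ⟨n - (k + k), by omega⟩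
  let e₀ : (Fin k ⊕ Fin k) ⊕ Fin m ≃ Fin n :=
    (finSumFinEquiv.sumCongr (Equiv.refl _)).trans (finSumFinEquiv.trans (finCongr hm.symm))
  obtain ⟨σ, hσ⟩ := exists_perm_extending (f := e₀ ∘ Sum.inl) (e₀.injective.comp Sum.inl_injective)
    hf
  let e := e₀.trans σ
  have hcol₁ : col₁ e F = sel F B.rowIdx * sel F r := by
    rw [sel_mul_sel]
    exact congr_arg (sel F) (funext fun x => hσ (Sum.inl x))
  have hcol₂ : col₂ e F = sel F B.colIdx * sel F c := by
    rw [sel_mul_sel]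
    exact congr_arg (sel F) (funext fun x => hσ (Sum.inr x))
  have : Nonempty (Fin m) := Fin.pos_iff_nonempty.1 (by omega)
  have hU' : HasURank χ₀ ρ (Fintype.card (Fin k)) := by rwa [Fintype.card_fin]
  obtain ⟨w, hw, hw0⟩ := exists_mem_charSpace_ne_zero e hχ₀ (ρ := ρ) hdet hv0 fun T g hg => by
    have hg' : g = B.unipotent (Multiplicative.ofAdd (sel F r * T * (sel F c)ᵀ)) := by
      ext1
      rw [hg, hcol₁, hcol₂, Matrix.transpose_mul]
      change _ = 1 + B.place (sel F r * T * (sel F c)ᵀ)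
      rw [B.place_eq]
      simp only [Matrix.mul_assoc]
    rw [hg', hv]
    congr 1
    change χ₀ (Matrix.trace (S * (sel F r * T * (sel F c)ᵀ))) = _
    have hsub : S.submatrix c r = (sel F c)ᵀ * S * sel F r := by
      ext x y
      simp [sel, Matrix.mul_apply, Matrix.one_apply]
    rw [hsub, ← Matrix.mul_assoc, ← Matrix.mul_assoc, Matrix.trace_mul_comm]
    simp only [Matrix.mul_assoc]
  refine occursIn_of_mem_charSpace e (fun ⟨x⟩ => ?_) hχ₀ hdet hU' hw hw0
  have := x.pos
  exact Fin.nontrivial_iff_two_le.2 (by omega)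

end LargeRank

/-! ### The commutant of `GL_n` on functions on matrices -/

section Commutant

/-- Möbius inversion on a finite partially ordered set. -/
theorem exists_eq_sum_le {P : Type*} [PartialOrder P] [Fintype P] [DecidableLE P] (h : P → ℂ) :
    ∃ a : P → ℂ, ∀ x, h x = ∑ y with y ≤ x, a y := by
  classical
  let a : P → ℂ := WellFoundedLT.fix fun x ih => h x - ∑ y : {y // y < x}, ih y.1 y.2
  have ha : ∀ x, a x = h x - ∑ y : {y // y < x}, a y := fun x => WellFoundedLT.fix_eq _ x
  refine ⟨a, fun x => ?_⟩
  have h1 : (Finset.univ.filter fun y => y ≤ x) = insert x (Finset.univ.filter fun y => y < x) := by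
    ext y
    simp [le_iff_eq_or_lt]
  rw [h1, Finset.sum_insert (by simp), ha x,
    Finset.sum_subtype (p := fun y => y < x) _ (by simp) a, sub_add_cancel]

variable {F : Type*} [Field F] {n : ℕ} {κ : Type*} [Fintype κ]

/-- The linear relations `X a = Y b` between the columns of two matrices `X` and `Y`. -/
def pairRel (X Y : Matrix (Fin n) κ F) : Submodule F ((κ → F) × (κ → F)) :=
  LinearMap.ker (X.mulVecLin.coprod (-Y.mulVecLin))

theorem mem_pairRel {X Y : Matrix (Fin n) κ F} {p : (κ → F) × (κ → F)} :
    p ∈ pairRel X Y ↔ X *ᵥ p.1 = Y *ᵥ p.2 := by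
  rw [pairRel, LinearMap.mem_ker, LinearMap.coprod_apply, LinearMap.neg_apply, ← sub_eq_add_neg,
    sub_eq_zero]
  rfl

theorem exists_gl_mulVec_eq {ν : Type*} [Fintype ν] [DecidableEq ν]
    (c : (ν → F) ≃ₗ[F] (ν → F)) : ∃ g : GL ν F, ∀ x, (g : Matrix ν ν F) *ᵥ x = c x := by
  refine ⟨⟨LinearMap.toMatrix' c.toLinearMap, LinearMap.toMatrix' c.symm.toLinearMap, ?_, ?_⟩,
    fun x => LinearMap.toMatrix'_mulVec _ x⟩
  · rw [← LinearMap.toMatrix'_comp, LinearEquiv.comp_symm, LinearMap.toMatrix'_id]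
  · rw [← LinearMap.toMatrix'_comp, LinearEquiv.symm_comp, LinearMap.toMatrix'_id]

/-- Two pairs of matrices with the same relations are in the same orbit of `GL_n`. -/
theorem exists_mul_eq_of_pairRel_eq [DecidableEq κ] {X Y X' Y' : Matrix (Fin n) κ F}
    (h : pairRel X Y = pairRel X' Y') :
    ∃ g : GL (Fin n) F, (g : Matrix (Fin n) (Fin n) F) * X = X' ∧
      (g : Matrix (Fin n) (Fin n) F) * Y = Y' := by
  let L := X.mulVecLin.coprod (-Y.mulVecLin)
  let L' := X'.mulVecLin.coprod (-Y'.mulVecLin)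
  let f : LinearMap.range L ≃ₗ[F] LinearMap.range L' :=
    L.quotKerEquivRange.symm ≪≫ₗ Submodule.quotEquivOfEq _ _ h ≪≫ₗ L'.quotKerEquivRange
  have hf : ∀ p, (f ⟨L p, LinearMap.mem_range_self L p⟩ : Fin n → F) = L' p := fun p => by
    have h1 : L.quotKerEquivRange.symm ⟨L p, LinearMap.mem_range_self L p⟩ =
        Submodule.Quotient.mk p := by
      rw [LinearEquiv.symm_apply_eq]
      rfl
    change (L'.quotKerEquivRange (Submodule.quotEquivOfEq _ _ h
      (L.quotKerEquivRange.symm ⟨L p, LinearMap.mem_range_self L p⟩)) : Fin n → F) = _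
    rw [h1]
    rfl
  obtain ⟨g₀, hg₀⟩ := Submodule.exists_linearEquiv_restrict_eq f
  obtain ⟨g, hg⟩ := exists_gl_mulVec_eq g₀
  have hL : ∀ p, (g : Matrix (Fin n) (Fin n) F) *ᵥ L p = L' p := fun p => by
    rw [hg, ← hf, hg₀]
  refine ⟨g, ?_, ?_⟩
  · refine Matrix.ext_of_mulVec_single fun b => ?_
    have h1 := hL (Pi.single b 1, 0)
    simp only [L, L', LinearMap.coprod_apply, map_zero, add_zero, Matrix.mulVecLin_apply] at h1
    rw [← Matrix.mulVec_mulVec, h1]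
  · refine Matrix.ext_of_mulVec_single fun b => ?_
    have h1 := hL (0, -Pi.single b 1)
    simp only [L, L', LinearMap.coprod_apply, map_zero, zero_add, LinearMap.neg_apply, map_neg,
      neg_neg, Matrix.mulVecLin_apply] at h1
    rw [← Matrix.mulVec_mulVec, h1]

/-- The operator on functions on `n × κ` matrices that sums over all `Y` satisfying, together with
`X`, the relations in `K`. -/
noncomputable def relOp [Fintype F] [DecidableEq κ] (n : ℕ) (K : Submodule F ((κ → F) × (κ → F))) :
    (Matrix (Fin n) κ F → ℂ) →ₗ[ℂ] (Matrix (Fin n) κ F → ℂ) :=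
  open scoped Classical in
  { toFun := fun f X => ∑ Y, if K ≤ pairRel X Y then f Y else 0
    map_add' := fun f f' => by
      funext X
      simp only [Pi.add_apply, ← Finset.sum_add_distrib]
      exact Finset.sum_congr rfl fun Y _ => by split_ifs <;> simp
    map_smul' := fun c f => by
      funext X
      simp [Finset.mul_sum] }

open scoped Classical in
theorem relOp_apply [Fintype F] [DecidableEq κ] (K : Submodule F ((κ → F) × (κ → F)))
    (f : Matrix (Fin n) κ F → ℂ) (X : Matrix (Fin n) κ F) :
    relOp n K f X = ∑ Y, if K ≤ pairRel X Y then f Y else 0 := rfl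

theorem pairRel_mul (g : GL (Fin n) F) (X Y : Matrix (Fin n) κ F) :
    pairRel ((g : Matrix (Fin n) (Fin n) F) * X) ((g : Matrix (Fin n) (Fin n) F) * Y) =
      pairRel X Y := by
  ext p
  rw [mem_pairRel, mem_pairRel, ← Matrix.mulVec_mulVec, ← Matrix.mulVec_mulVec]
  refine ⟨fun h => ?_, fun h => by rw [h]⟩
  simpa [Matrix.mulVec_mulVec] using
    congr_arg (((g⁻¹ : GL (Fin n) F) : Matrix (Fin n) (Fin n) F) *ᵥ ·) h

theorem relOp_matRep [Fintype F] [DecidableEq κ] (K : Submodule F ((κ → F) × (κ → F)))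
    (g : GL (Fin n) F) (f : Matrix (Fin n) κ F → ℂ) :
    relOp n K (matRep F n κ g f) = matRep F n κ g (relOp n K f) := by
  funext X
  rw [matRep_apply, relOp_apply, relOp_apply]
  let m : Matrix (Fin n) κ F ≃ Matrix (Fin n) κ F :=
    ⟨fun Y => ((g⁻¹ : GL (Fin n) F) : Matrix (Fin n) (Fin n) F) * Y,
      fun Y => (g : Matrix (Fin n) (Fin n) F) * Y, fun Y => by simp [← Matrix.mul_assoc],
      fun Y => by simp [← Matrix.mul_assoc]⟩
  refine Fintype.sum_equiv m _ _ fun Y => ?_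
  have hm : m Y = ((g⁻¹ : GL (Fin n) F) : Matrix (Fin n) (Fin n) F) * Y := rfl
  rw [hm, pairRel_mul, matRep_apply]

/-- The commutant of the action of `GL_n` on the functions on matrices is spanned by the operators
`relOp`: the kernel of an equivariant operator is a function of the relations, and Möbius inversion
turns it into a combination of the functions "the relations contain `K`". -/
theorem exists_eq_sum_relOp [Fintype F] [DecidableEq κ] [Fintype (Submodule F ((κ → F) × (κ → F)))]
    (Q : (Matrix (Fin n) κ F → ℂ) →ₗ[ℂ] (Matrix (Fin n) κ F → ℂ))
    (hQ : ∀ g f, Q (matRep F n κ g f) = matRep F n κ g (Q f)) :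
    ∃ a : Submodule F ((κ → F) × (κ → F)) → ℂ, ∀ f, Q f = ∑ K, a K • relOp n K f := by
  classical
  have hq : ∀ (g : GL (Fin n) F) (X Y : Matrix (Fin n) κ F),
      Q (Pi.single ((g : Matrix (Fin n) (Fin n) F) * Y) 1) ((g : Matrix (Fin n) (Fin n) F) * X) =
        Q (Pi.single Y 1) X := fun g X Y => by
    have h1 : matRep F n κ g (Pi.single Y 1) =
        Pi.single ((g : Matrix (Fin n) (Fin n) F) * Y) 1 := by
      funext Z
      rw [matRep_apply, Pi.single_apply, Pi.single_apply]
      refine if_congr ⟨?_, ?_⟩ rfl rfl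
      · rintro rfl
        simp [← Matrix.mul_assoc]
      · rintro rfl
        simp [← Matrix.mul_assoc]
    rw [← h1, hQ, matRep_apply]
    simp [← Matrix.mul_assoc]
  have hfac : ∀ X Y X' Y' : Matrix (Fin n) κ F, pairRel X Y = pairRel X' Y' →
      Q (Pi.single Y 1) X = Q (Pi.single Y' 1) X' := fun X Y X' Y' h => by
    obtain ⟨g, rfl, rfl⟩ := exists_mul_eq_of_pairRel_eq h
    exact (hq g X Y).symm
  obtain ⟨φ, hφ⟩ : ∃ φ : Submodule F ((κ → F) × (κ → F)) → ℂ,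
      ∀ X Y : Matrix (Fin n) κ F, Q (Pi.single Y 1) X = φ (pairRel X Y) := by
    refine ⟨fun K => if h : ∃ p : Matrix (Fin n) κ F × Matrix (Fin n) κ F, pairRel p.1 p.2 = K then
      Q (Pi.single h.choose.2 1) h.choose.1 else 0, fun X Y => ?_⟩
    have h : ∃ p : Matrix (Fin n) κ F × Matrix (Fin n) κ F, pairRel p.1 p.2 = pairRel X Y :=
      ⟨(X, Y), rfl⟩
    simp only [dif_pos h]
    exact (hfac _ _ _ _ h.choose_spec).symm
  obtain ⟨a, ha⟩ := exists_eq_sum_le φ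
  refine ⟨a, fun f => funext fun X => ?_⟩
  have hf : f = ∑ Y, f Y • (Pi.single Y 1 : Matrix (Fin n) κ F → ℂ) := by
    funext Z
    simp [Pi.single_apply]
  have h1 : Q f X = ∑ Y, f Y * Q (Pi.single Y 1) X := by
    nth_rw 1 [hf]
    rw [map_sum, Finset.sum_apply]
    simp
  simp only [h1, hφ, ha, Finset.sum_apply, Pi.smul_apply, relOp_apply, smul_eq_mul,
    Finset.mul_sum, Finset.sum_filter]
  rw [Finset.sum_comm]
  refine Finset.sum_congr rfl fun K _ => Finset.sum_congr rfl fun Y _ => ?_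
  split_ifs
  · rw [mul_comm]
  · simp

end Commutant

/-! ### Spaces of relations that are not graphs -/

section Relations

variable {F : Type*} [Field F] {n m : ℕ}

theorem eq_mul_of_row_eq_zero {M : Matrix (Fin (m + 1)) (Fin (m + 1)) F} {i : Fin (m + 1)}
    (h : ∀ j, M i j = 0) : M = sel F i.succAbove * ((sel F i.succAbove)ᵀ * M) := by
  ext x y
  rw [← Matrix.mul_assoc, Matrix.mul_apply, Fin.sum_univ_succAbove _ i]
  rcases Fin.eq_self_or_eq_succAbove i x with rfl | ⟨z, rfl⟩
  · simp [sel, Matrix.mul_apply, Matrix.one_apply, h]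
  · simp [sel, Matrix.mul_apply, Matrix.one_apply, h]

theorem eq_mul_of_col_eq_zero {M : Matrix (Fin (m + 1)) (Fin (m + 1)) F} {i : Fin (m + 1)}
    (h : ∀ j, M j i = 0) : M = M * sel F i.succAbove * (sel F i.succAbove)ᵀ := by
  have h1 := congr_arg Matrix.transpose (eq_mul_of_row_eq_zero (M := Mᵀ) h)
  rw [Matrix.transpose_transpose, Matrix.transpose_mul, Matrix.transpose_mul,
    Matrix.transpose_transpose, Matrix.transpose_transpose] at h1
  exact h1

/-- The graph `{(C b, b)}` of a square matrix, as a space of relations. -/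
def graphRel {κ : Type*} [Fintype κ] (C : Matrix κ κ F) : Submodule F ((κ → F) × (κ → F)) :=
  LinearMap.ker ((LinearMap.fst F (κ → F) (κ → F)) - C.mulVecLin ∘ₗ LinearMap.snd F _ _)

theorem mem_graphRel {κ : Type*} [Fintype κ] {C : Matrix κ κ F} {p : (κ → F) × (κ → F)} :
    p ∈ graphRel C ↔ p.1 = C *ᵥ p.2 := by
  rw [graphRel, LinearMap.mem_ker, LinearMap.sub_apply, sub_eq_zero]
  rfl

theorem relOp_graphRel {κ : Type*} [Fintype κ] [DecidableEq κ] [Fintype F] (C : Matrix κ κ F)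
    (f : Matrix (Fin n) κ F → ℂ) (X : Matrix (Fin n) κ F) :
    relOp n (graphRel C) f X = f (X * C) := by
  classical
  have h : ∀ Y, graphRel C ≤ pairRel X Y ↔ Y = X * C := fun Y => by
    constructor
    · intro h
      refine Matrix.ext_of_mulVec_single fun b => ?_
      have h1 := mem_pairRel.1 (h (mem_graphRel.2
        (rfl : (C *ᵥ Pi.single b 1, Pi.single b 1).1 = _)))
      rw [← Matrix.mulVec_mulVec]
      exact h1.symm
    · rintro rfl p hp
      rw [mem_pairRel, mem_graphRel.1 hp, Matrix.mulVec_mulVec]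
  simp [relOp_apply, h]

/-- A space of relations that is not a graph of an invertible matrix gives an operator whose values
are determined by the restriction to matrices `Z D`, with `D` of smaller size. -/
theorem eq_graphRel_or_exists_factor [Fintype F] (n : ℕ)
    (K : Submodule F ((Fin (m + 1) → F) × (Fin (m + 1) → F))) :
    (∃ C : GL (Fin (m + 1)) F, K = graphRel (C : Matrix (Fin (m + 1)) (Fin (m + 1)) F)) ∨
      ∃ D : Matrix (Fin m) (Fin (m + 1)) F, ∀ f : Matrix (Fin n) (Fin (m + 1)) F → ℂ,
        (∀ Z : Matrix (Fin n) (Fin m) F, relOp n K f (Z * D) = 0) → relOp n K f = 0 := by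
  classical
  by_cases ha : ∃ a, a ≠ 0 ∧ (a, (0 : Fin (m + 1) → F)) ∈ K
  · obtain ⟨a, ha0, haK⟩ := ha
    obtain ⟨i, hi⟩ := Function.ne_iff.1 ha0
    right
    -- `relOp n K f` is supported on the `X` with `X a = 0`; those are the `X` with `X M = X`.
    let M : Matrix (Fin (m + 1)) (Fin (m + 1)) F := 1 - Matrix.vecMulVec a (Pi.single i (a i)⁻¹)
    have hM : M = _ := eq_mul_of_row_eq_zero (M := M) (i := i) fun j => by
      by_cases hij : i = j
      · subst hij
        simp [M, Matrix.vecMulVec_apply, mul_inv_cancel₀ hi]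
      · simp [M, Matrix.vecMulVec_apply, hij, Ne.symm hij]
    refine ⟨(sel F i.succAbove)ᵀ * M, fun f hf => funext fun X => ?_⟩
    by_cases hX : X *ᵥ a = 0
    · have h1 : X * M = X := by
        simp [M, Matrix.mul_sub, Matrix.mul_vecMulVec, hX]
      have h2 := hf (X * sel F i.succAbove)
      rw [Matrix.mul_assoc, ← hM, h1] at h2
      exact h2
    · rw [relOp_apply]
      refine Finset.sum_eq_zero fun Y _ => if_neg fun h => hX ?_
      simpa using mem_pairRel.1 (h haK)
  by_cases hK : K.map (LinearMap.fst F _ _) = ⊤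
  · left
    let p := LinearMap.fst F (Fin (m + 1) → F) (Fin (m + 1) → F) ∘ₗ K.subtype
    let s := LinearMap.snd F (Fin (m + 1) → F) (Fin (m + 1) → F) ∘ₗ K.subtype
    have hp : Function.Surjective p := by
      rw [← LinearMap.range_eq_top, LinearMap.range_comp, Submodule.range_subtype, hK]
    have hs : Function.Injective s := by
      rw [← LinearMap.ker_eq_bot, LinearMap.ker_eq_bot']
      rintro ⟨⟨x, y⟩, hxy⟩ (rfl : y = 0)
      by_cases hx : x = 0
      · subst hx
        rfl
      · exact absurd ⟨x, hx, hxy⟩ ha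
    have hdim : Module.finrank F K = Module.finrank F (Fin (m + 1) → F) :=
      (LinearMap.finrank_le_finrank_of_injective hs).antisymm
        (LinearMap.finrank_le_finrank_of_surjective hp)
    let eₚ := LinearEquiv.ofBijective p
      ⟨(LinearMap.injective_iff_surjective_of_finrank_eq_finrank hdim).2 hp, hp⟩
    let eₛ := LinearEquiv.ofBijective s
      ⟨hs, (LinearMap.injective_iff_surjective_of_finrank_eq_finrank hdim).1 hs⟩
    obtain ⟨C, hC⟩ := exists_gl_mulVec_eq (eₛ.symm ≪≫ₗ eₚ)
    refine ⟨C, le_antisymm (fun q hq => ?_) fun q hq => ?_⟩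
    · rw [mem_graphRel, hC]
      have h1 : eₛ.symm q.2 = ⟨q, hq⟩ := by
        rw [LinearEquiv.symm_apply_eq]
        rfl
      rw [LinearEquiv.trans_apply, h1]
      rfl
    · rw [mem_graphRel, hC] at hq
      have h1 : q = eₛ.symm q.2 := Prod.ext hq (eₛ.apply_symm_apply q.2).symm
      rw [h1]
      exact (eₛ.symm q.2).2
  · right
    obtain ⟨φ, hφ0, hφ⟩ := Submodule.exists_le_ker_of_lt_top _ (lt_top_iff_ne_top.2 hK)
    let w : Fin (m + 1) → F := fun j => φ (Pi.single j 1)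
    have hw : ∀ x, φ x = w ⬝ᵥ x := fun x => by
      conv_lhs => rw [pi_eq_sum_univ' x]
      simp [w, dotProduct, mul_comm]
    have hw0 : w ≠ 0 := fun h => hφ0 (LinearMap.ext fun x => by simp [hw, h])
    obtain ⟨i, hi⟩ := Function.ne_iff.1 hw0
    -- `relOp n K f X` depends only on the restriction of `X` to the kernel of `φ`, which `M` fixes.
    let M : Matrix (Fin (m + 1)) (Fin (m + 1)) F := 1 - Matrix.vecMulVec (Pi.single i (w i)⁻¹) w
    have hM : M = _ := eq_mul_of_col_eq_zero (M := M) (i := i) fun j => by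
      by_cases hij : j = i
      · subst hij
        simp [M, Matrix.vecMulVec_apply, inv_mul_cancel₀ hi]
      · simp [M, Matrix.vecMulVec_apply, hij]
    refine ⟨(sel F i.succAbove)ᵀ, fun f hf => funext fun X => ?_⟩
    rw [Pi.zero_apply, ← hf (X * (M * sel F i.succAbove)), Matrix.mul_assoc, ← hM, relOp_apply,
      relOp_apply]
    refine Finset.sum_congr rfl fun Y _ => if_congr ?_ rfl rfl
    refine forall₂_congr fun p hp => ?_
    have h1 : M *ᵥ p.1 = p.1 := by
      have h2 : w ⬝ᵥ p.1 = 0 := by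
        rw [← hw]
        exact hφ (Submodule.mem_map_of_mem (f := LinearMap.fst F _ _) hp)
      simp [M, Matrix.sub_mulVec, Matrix.vecMulVec_mulVec, h2]
    rw [mem_pairRel, mem_pairRel, ← Matrix.mulVec_mulVec, h1]

end Relations

/-! ### Reducing the number of columns -/

section Descent

variable {F : Type*} [Field F] [Finite F] {n m k : ℕ} {V : Type*} [AddCommGroup V] [Module ℂ V]
  {χ₀ : AddChar F ℂ} {ρ : Representation ℂ (GL (Fin n) F) V}

/-- If `ρ` occurs in the functions on matrices with `m + 1` columns, then either one column can be
removed, or a character of rank `m + 1` appears in `ρ`. -/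
theorem OccursIn.pred_or_lt [ρ.IsIrreducible] (hχ₀ : χ₀ ≠ 1) (hU : HasURank χ₀ ρ k)
    (h : OccursIn (Fin (m + 1)) ρ) (hn : 3 ≤ n) (hmn : (m + 1) + (m + 1) ≤ n) :
    OccursIn (Fin m) ρ ∨ m < k := by
  classical
  have := Fintype.ofFinite F
  have := Fintype.ofFinite (Submodule F ((Fin (m + 1) → F) × (Fin (m + 1) → F)))
  obtain ⟨χ, ι, hι⟩ := h
  obtain ⟨T, hT⟩ := exists_intertwining_retraction ι hι
  let r : Fin (m + 1) → Fin n := fun i => Fin.castLE hmn (Fin.castAdd (m + 1) i)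
  let c : Fin (m + 1) → Fin n := fun i => Fin.castLE hmn (Fin.natAdd (m + 1) i)
  have hr : Function.Injective r := fun x y hxy => by
    simpa [r, Fin.ext_iff] using hxy
  have hc : Function.Injective c := fun x y hxy => by
    simpa [c, Fin.ext_iff] using hxy
  have hrc : ∀ a b, r a ≠ c b := fun a b hab => by
    have := congr_arg Fin.val hab
    simp [r, c] at this
    omega
  -- an eigenvector of the matrix subgroup with rows `r` and columns `c`, with the character given
  -- by the identity matrix
  let e : Matrix (Fin n) (Fin (m + 1)) F → ℂ := fun X =>
    if (sel F c)ᵀ * X = 1 then χ₀ (-((sel F r)ᵀ * X).trace) else 0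
  have he : ∀ S, matRep F n (Fin (m + 1))
      (oneAdd (sel F r * S * (sel F c)ᵀ) (sel_mul_transpose_mul_self hrc S S)) e =
        χ₀ S.trace • e := fun S => by
    funext X
    have h1 : (sel F c)ᵀ * sel F r = 0 := sel_transpose_mul_sel_of_ne fun b a => (hrc a b).symm
    have h2 : (sel F r)ᵀ * sel F r = 1 := sel_transpose_mul_sel_self hr
    rw [matRep_apply, coe_inv_oneAdd, Pi.smul_apply]
    simp only [e, Matrix.sub_mul, Matrix.mul_sub, Matrix.one_mul, Matrix.mul_assoc,
      mul_assoc_of_mul_eq h1, mul_assoc_of_mul_eq h2, Matrix.zero_mul, sub_zero]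
    by_cases hX : (sel F c)ᵀ * X = 1
    · simp only [hX, if_true, Matrix.mul_one, Matrix.trace_sub, neg_sub, smul_eq_mul]
      rw [sub_eq_add_neg, AddChar.map_add_eq_mul]
    · simp only [hX, if_false, smul_zero]
  by_cases hTe : T e = 0
  swap
  · right
    have h1 := hU.rank_le hr hc hrc (S := 1) hTe fun S g hg => by
      have hg' : g = oneAdd (sel F r * S * (sel F c)ᵀ) (sel_mul_transpose_mul_self hrc S S) := by
        ext1
        exact hg
      rw [← T.isIntertwining, twist_apply, hg', he, character_unipotent hn χ hrc S, Units.val_one,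
        one_smul, map_smul, Matrix.one_mul]
    rw [Matrix.rank_one, Fintype.card_fin] at h1
    exact h1
  left
  let Q := ι.toLinearMap ∘ₗ T.toLinearMap
  have hQ' : ∀ f, Q f = ι (T f) := fun f => rfl
  have hQ : ∀ g f, Q (matRep F n _ g f) = matRep F n _ g (Q f) := fun g f => by
    have h1 : (χ g : ℂ) • Q (matRep F n _ g f) = (χ g : ℂ) • matRep F n _ g (Q f) := by
      rw [← map_smul, ← twist_apply, ← twist_apply, hQ', hQ', T.isIntertwining, ι.isIntertwining]
    exact smul_right_injective _ (χ g).ne_zero h1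
  obtain ⟨a, ha⟩ := exists_eq_sum_relOp Q hQ
  -- `relOp n K e` pulled back to fewer columns is an eigenvector with a character of too large rank
  have hbad : ∀ (K : Submodule F ((Fin (m + 1) → F) × (Fin (m + 1) → F)))
      (D : Matrix (Fin m) (Fin (m + 1)) F),
      (∀ f, (∀ Z : Matrix (Fin n) (Fin m) F, relOp n K f (Z * D) = 0) → relOp n K f = 0) →
        relOp n K e = 0 := fun K D hD => by
    refine hD e fun Z => ?_
    by_contra hZ
    have h1 := rank_le_of_matRep_eigenvector hχ₀ hrc (S := 1)
      (f := fun Z : Matrix (Fin n) (Fin m) F => relOp n K e (Z * D))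
      (fun h0 => hZ (congr_fun h0 Z)) fun S => by
        funext Z
        rw [matRep_apply, Matrix.mul_assoc, ← matRep_apply _ (relOp n K e), ← relOp_matRep, he,
          map_smul, Matrix.one_mul]
        rfl
    rw [Matrix.rank_one, Fintype.card_fin, Fintype.card_fin] at h1
    omega
  -- evaluating `Q e = 0` at a matrix where only the translate of `e` by `C` does not vanish
  have hgood : ∀ C : GL (Fin (m + 1)) F,
      a (graphRel (C : Matrix (Fin (m + 1)) (Fin (m + 1)) F)) = 0 := fun C => by
    have hcc : (sel F c)ᵀ * sel F c = 1 := sel_transpose_mul_sel_self hc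
    have hrc' : (sel F r)ᵀ * sel F c = 0 := sel_transpose_mul_sel_of_ne hrc
    have h1 := congr_fun (ha e) (sel F c *
      ((C⁻¹ : GL (Fin (m + 1)) F) : Matrix (Fin (m + 1)) (Fin (m + 1)) F))
    rw [hQ', hTe, map_zero, Finset.sum_apply, Finset.sum_eq_single_of_mem
      (graphRel (C : Matrix (Fin (m + 1)) (Fin (m + 1)) F)) (Finset.mem_univ _)] at h1
    · simpa [relOp_graphRel, e, Matrix.mul_assoc, hcc, hrc'] using h1.symm
    · intro K _ hK
      rcases eq_graphRel_or_exists_factor n K with ⟨C', rfl⟩ | ⟨D, hD⟩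
      · have h2 : (sel F c)ᵀ * (sel F c *
            ((C⁻¹ : GL (Fin (m + 1)) F) : Matrix (Fin (m + 1)) (Fin (m + 1)) F) *
              (C' : Matrix (Fin (m + 1)) (Fin (m + 1)) F)) ≠ 1 :=
          fun h2 => hK (by
            rw [Matrix.mul_assoc, mul_assoc_of_mul_eq hcc, Matrix.one_mul] at h2
            have h3 : C⁻¹ * C' = 1 := Units.ext h2
            rw [inv_mul_eq_one.1 h3])
        rw [Pi.smul_apply, relOp_graphRel]
        simp only [e, h2, if_false, smul_zero]
      · rw [hbad K D hD]
        simp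
  obtain ⟨-, -, -, -, ⟨v, hv, -⟩, -⟩ := hU.1
  have hιv : ι v ≠ 0 := fun h0 => hv (hι (h0.trans (map_zero ι).symm))
  obtain ⟨K, hK⟩ : ∃ K, a K • relOp n K (ι v) ≠ 0 := by
    by_contra! h0
    refine hιv ?_
    nth_rw 1 [← hT v]
    rw [← hQ', ha]
    exact Finset.sum_eq_zero fun K _ => h0 K
  rcases eq_graphRel_or_exists_factor n K with ⟨C, rfl⟩ | ⟨D, hD⟩
  · exact absurd (by rw [hgood, zero_smul]) hK
  obtain ⟨Z, hZ⟩ : ∃ Z : Matrix (Fin n) (Fin m) F, relOp n K (ι v) (Z * D) ≠ 0 := by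
    by_contra! h0
    exact hK (by rw [hD _ h0, smul_zero])
  let Φ : ρ.IntertwiningMap (twist χ (matRep F n (Fin m))) :=
    (LinearMap.funLeft ℂ ℂ (fun Z : Matrix (Fin n) (Fin m) F => Z * D) ∘ₗ relOp n K ∘ₗ
      ι.toLinearMap).intertwiningMap_of_isIntertwiningMap _ _ fun g v => by
        have h1 : ι.toLinearMap (ρ g v) = (χ g : ℂ) • matRep F n _ g (ι v) :=
          ι.isIntertwining _ _ g v
        funext Z
        simp only [LinearMap.comp_apply, LinearMap.funLeft_apply, h1, map_smul, relOp_matRep]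
        rw [twist_apply, Pi.smul_apply, Pi.smul_apply, matRep_apply, matRep_apply,
          LinearMap.funLeft_apply, Matrix.mul_assoc]
        rfl
  refine ⟨χ, Φ, (Representation.IsIrreducible.injective_or_eq_zero Φ).resolve_right fun h0 => hZ ?_⟩
  have h1 : Φ v = 0 := by
    rw [h0]
    rfl
  exact congr_fun h1 Z

end Descent

end GLRank

theorem proposition11p2 {F : Type*} [Field F] [Finite F] (χ₀ : AddChar F ℂ) (hχ₀ : χ₀ ≠ 1)
    (n k : ℕ) (hk : (k : ℝ) < (n : ℝ) / 4)
    {V : Type*} [AddCommGroup V] [Module ℂ V] [FiniteDimensional ℂ V]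
    (ρ : Representation ℂ (GL (Fin n) F) V) (hρ : ρ.IsIrreducible)
    (hU : GLRank.HasURank χ₀ ρ k) :
    GLRank.HasTensorRank ρ k := by
  classical
  have hk4 : 4 * k < n := by
    have h1 : (4 : ℝ) * k < n := by linarith
    exact_mod_cast h1
  have hlow : ∀ ℓ, GLRank.OccursIn (Fin ℓ) ρ → k ≤ ℓ := fun ℓ hℓ => by
    rcases Nat.eq_zero_or_pos k with rfl | hk0
    · exact Nat.zero_le ℓ
    obtain ⟨χ, f, hf⟩ := hℓ
    obtain ⟨a, b, B, S, ⟨v, hv0, hv⟩, hS⟩ := hU.1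
    have hB : ∀ s t, B.rowIdx s ≠ B.colIdx t := fun s t => (B.colIdx_ne_rowIdx t s).symm
    have h1 := GLRank.rank_le_of_matRep_eigenvector hχ₀ hB (S := S) (f := f v)
      (fun h0 => hv0 (hf (h0.trans (map_zero f).symm))) fun T => by
        have hu : GLRank.oneAdd _ (GLRank.sel_mul_transpose_mul_self hB T T) =
            B.unipotent (Multiplicative.ofAdd T) := by
          ext1
          rw [GLRank.coe_oneAdd, ← B.place_eq]
          rfl
        have h2 := f.isIntertwining _ _ (B.unipotent (Multiplicative.ofAdd T)) v
        rw [hv, map_smul, GLRank.twist_apply, ← hu,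
          GLRank.character_unipotent (by omega) χ hB T, Units.val_one, one_smul] at h2
        exact h2.symm
    rwa [hS, Fintype.card_fin] at h1
  have hex : ∃ ℓ, GLRank.OccursIn (Fin ℓ) ρ :=
    ⟨k + k, (hU.occursIn hχ₀ (by omega) (by omega)).reindex finSumFinEquiv⟩
  have hle : Nat.find hex ≤ k + k :=
    Nat.find_min' hex ((hU.occursIn hχ₀ (by omega) (by omega)).reindex finSumFinEquiv)
  have hfind : Nat.find hex ≤ k := by
    rcases hr : Nat.find hex with _ | m
    · exact Nat.zero_le k
    have h1 : GLRank.OccursIn (Fin (m + 1)) ρ := hr ▸ Nat.find_spec hex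
    rcases h1.pred_or_lt hχ₀ hU (by omega) (by omega) with h2 | h2
    · exact absurd h2 (Nat.find_min hex (by omega))
    · exact h2
  refine ⟨GLRank.OccursIn.tensorRankLE ?_, fun m hm => ?_⟩
  · rw [← hfind.antisymm (hlow _ (Nat.find_spec hex))]
    exact Nat.find_spec hex
  · obtain ⟨ℓ, hℓ, h1⟩ := GLRank.TensorRankLE.occursIn hm
    exact (hlow ℓ h1).trans hℓ
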